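/- Let $\langle \mathcal A \,\|\, \mathcal R\rangle$ be a finite group presentation, i.e. $\mathcal A$ is a finite alphabet and $\mathcal R$ is a finite set of nonempty cyclically reduced words over $\mathcal A^{\pm1}$. A van Kampen diagram over it is a finite, connected, simply connected planar 2-complex $\Delta$ with a cellular map to the standard 2-complex of the presentation that is a homeomorphism on every open cell; thus the oriented edges of $\Delta$ are labelled by letters of $\mathcal A^{\pm1}$ (inverse edges by inverse letters) and the boundary of every 2-cell is labelled, as a cyclic word, by $R$ or $R^{-1}$ for some $R\in\mathcal R$. Let $\langle\langle \mathcal R\rangle\rangle$ be the normal closure of $\mathcal R$ in the free group $F(\mathcal A)$. For $j\in\{0,1,2\}$ and a word $W$ over $\mathcal A^{\pm1}$ representing an element of $\langle\langle \mathcal R\rangle\rangle$, let $L_j(W)$ be the minimal number of $j$-cells in a van Kampen diagram whose boundary path is labelled by the cyclic word $W$, and for integers $x\ge 1$ let $f_j(x)$ be the maximum of $L_j(W)$ over all such words $W$ of length at most $x$. For functions $f,g$ from the positive to the non-negative integers write $f\preccurlyeq g$ if there is an integer $C>0$ with $f(x)\le C\,g(Cx)+Cx$ for all integers $x\ge1$,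 and call $f,g$ linearly equivalent if $f\preccurlyeq g$ and $g\preccurlyeq f$. Theorem 1.7. The Dehn functions $f_0$, $f_1$, $f_2$ of the finite presentation $\langle \mathcal A \,\|\, \mathcal R\rangle$ are pairwise linearly equivalent. -/

import Mathlib

/-- A group presentation `⟨ α ‖ relators ⟩`. A word over the alphabet `α ∪ α⁻¹` is a list of pairs,
`(a, true)` standing for the letter `a` and `(a, false)` for the letter `a⁻¹`. The relators are
nonempty cyclically reduced words. -/
structure GroupPresentation (α : Type*) where
  relators : Set (List (α × Bool))
  ne_nil : ∀ R ∈ relators, R ≠ []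
  cyclicallyReduced : ∀ R ∈ relators, FreeGroup.IsCyclicallyReduced R

/-- The word `w` belongs to the normal closure of the relators in the free group on `α`. -/
def GroupPresentation.IsTrivialWord {α : Type*} (P : GroupPresentation α)
    (w : List (α × Bool)) : Prop :=
  FreeGroup.mk w ∈ Subgroup.normalClosure (FreeGroup.mk '' P.relators)

/-- The reversal of oriented edges: `(e, true)` and `(e, false)` are the two orientations of `e`. -/
def reverseEdge (E : Type) : Equiv.Perm (E × Bool) where
  toFun d := (d.1, !d.2)
  invFun d := (d.1, !d.2)
  left_inv d := by simp
  right_inv d := by simp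

/-- The word read along the cycle `d, next d, next (next d), …` of oriented edges, once around,
where `(e, true)` reads as `letter e` and `(e, false)` as its inverse. -/
noncomputable def cycleLabel {α : Type*} {E : Type} (letter : E → α)
    (next : Equiv.Perm (E × Bool)) (d : E × Bool) : List (α × Bool) :=
  (List.iterate next d (Function.minimalPeriod next d)).map (fun c => (letter c.1, c.2))

/-- A van Kampen diagram over `P`: a finite, connected, simply connected planar 2-complex with a
cellular map, homeomorphic on every open cell, to the 2-complex of the presentation.

The complement of such a complex in the sphere is an open disc (the outer face), so the complex
is a cellular decomposition of the sphere with one 2-cell, the outer one, removed. The decomposition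
is given by its combinatorial map. The oriented edges are the elements of `Edge × Bool`, and
`next d` is the oriented edge that follows `d` when one walks around the face on the left of `d`.
Hence the orbits of `next` are the boundary cycles of the faces (the outer one included), and
the orbits of `d ↦ next d⁻¹`, which turns an oriented edge around its origin, are the sets
of oriented edges that leave a given vertex. Only the complex that consists of a single vertex
has no edges. A connected combinatorial map describes a decomposition of the sphere exactly if
`V - E + F = 2`, that is `V - E + F = 1` when the outer face is not counted. -/
structure VanKampenDiagram {α : Type*} (P : GroupPresentation α) where
  /-- The 0-cells. -/
  Vertex : Type
  /-- The 1-cells. Each is oriented so that it maps to a letter of `α` (not to an inverse). -/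
  Edge : Type
  /-- The 2-cells; the outer face is not one of them. -/
  Face : Type
  finite_vertex : Finite Vertex
  finite_edge : Finite Edge
  finite_face : Finite Face
  /-- The letter that labels the positive orientation of an edge. -/
  letter : Edge → α
  /-- The successor of an oriented edge on the boundary cycle of the face on its left. -/
  next : Equiv.Perm (Edge × Bool)
  /-- The initial vertex of an oriented edge. -/
  origin : Edge × Bool → Vertex
  /-- The face on the left of an oriented edge; `none` is the outer face. -/
  leftFace : Edge × Bool → Option Face
  origin_eq_iff : ∀ d d' : Edge × Bool,
    origin d = origin d' ↔ (next * reverseEdge Edge).SameCycle d d'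
  leftFace_eq_iff : ∀ d d' : Edge × Bool, leftFace d = leftFace d' ↔ next.SameCycle d d'
  exists_leftFace_eq_some : ∀ f : Face, ∃ d, leftFace d = some f
  exists_leftFace_eq_none : Nonempty Edge → ∃ d, leftFace d = none
  nonempty_vertex : Nonempty Vertex
  connected : ∀ v v' : Vertex,
    Relation.ReflTransGen (fun u u' => ∃ d, origin d = u ∧ origin (reverseEdge Edge d) = u') v v'
  euler : Nat.card Vertex + Nat.card Face = Nat.card Edge + 1
  /-- The boundary cycle of every 2-cell is labelled, up to the choice of the starting point, by
  a relator or by the inverse of a relator. -/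
  relator : ∀ d : Edge × Bool, leftFace d ≠ none → ∃ R ∈ P.relators,
    (cycleLabel letter next d).IsRotated R ∨
    (cycleLabel letter next d).IsRotated (FreeGroup.invRev R)

namespace VanKampenDiagram

variable {α : Type*} {P : GroupPresentation α} (Δ : VanKampenDiagram P)

/-- The label of the boundary cycle of the face on the left of `d`, read once around from `d`. -/
noncomputable def faceLabel (d : Δ.Edge × Bool) : List (α × Bool) :=
  cycleLabel Δ.letter Δ.next d

/-- The cyclic word `w` is the label of the boundary path of the diagram, i.e. of the boundary cycle
of the outer face (read from any starting point); the boundary of the diagram that consists of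
a single vertex is labelled by the empty word. -/
def IsBoundaryLabel (w : List (α × Bool)) : Prop :=
  (∃ d, Δ.leftFace d = none ∧ Δ.faceLabel d = w) ∨ (IsEmpty Δ.Edge ∧ w = [])

/-- The number of `j`-cells of the diagram, for `j = 0, 1, 2`. -/
noncomputable def numCells (j : Fin 3) : ℕ :=
  match j with
  | 0 => Nat.card Δ.Vertex
  | 1 => Nat.card Δ.Edge
  | 2 => Nat.card Δ.Face

end VanKampenDiagram

namespace GroupPresentation

variable {α : Type*} (P : GroupPresentation α)

/-- The minimal number of `j`-cells in a van Kampen diagram whose boundary is labelled by `w`. -/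
noncomputable def minCells (j : Fin 3) (w : List (α × Bool)) : ℕ :=
  sInf {n | ∃ Δ : VanKampenDiagram P, Δ.IsBoundaryLabel w ∧ Δ.numCells j = n}

/-- The Dehn `j`-function of a presentation with a finite alphabet: the maximum of `minCells j w`
over the words `w` of length at most `x` in the normal closure of the relators. -/
noncomputable def dehn (j : Fin 3) (x : ℕ) : ℕ :=
  sSup {n | ∃ w : List (α × Bool), P.IsTrivialWord w ∧ w.length ≤ x ∧ P.minCells j w = n}

end GroupPresentation

/-- `f ≼ g`: there is an integer `C > 0` with `f x ≤ C g (C x) + C x` for all `x ≥ 1`. -/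
def LinearlyDominated (f g : ℕ → ℕ) : Prop :=
  ∃ C : ℕ, 0 < C ∧ ∀ x : ℕ, 1 ≤ x → f x ≤ C * g (C * x) + C * x

/-- Linear equivalence `f ≃ g`: both `f ≼ g` and `g ≼ f`. -/
def LinearlyEquivalent (f g : ℕ → ℕ) : Prop :=
  LinearlyDominated f g ∧ LinearlyDominated g f

/-! Two inequalities are counts inside one diagram with `V` vertices, `E` edges and `F` faces.
Euler's formula gives `V ≤ E + 1`. Every oriented edge lies on the boundary of exactly one face, so
`2E ≤ M F + |w|` if the relators have length at most `M`. Hence `L₀ ≤ L₁ + 1` and `L₁ ≤ M L₂ + |w|`,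
and it remains to bound `L₂` linearly by `L₀` and `|w|` (`exists_minCells_two_le`). This cannot be a
count in a given diagram, since loops and parallel edges allow many faces on few vertices; a new
diagram is built.

Peel a diagram edge by edge from its boundary (`Decomposes`): the first boundary edge is a bridge or
separates a face from the outer face. Along the way follow, instead of the boundary word `w`, a word
`w'` obtained by deleting the letters that are trivial in the group and replacing the others by
equal letters. Loops and parallel edges then cost nothing, and any face that does cost area makes
`w'` shorter. If `c` bounds the area of all trivial words of length at most `M + 2`, induction gives
`area(w') + c|w'| + 2c ≤ 2cV` (`Decomposes.exists_letterwiseEq`). Recovering `w` from `w'` costs at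
most `c|w|`, so `w` has area at most `2cV + c|w|`. By van Kampen's lemma
(`AreaLE.exists_decomposes`, `Decomposes.exists_diagram`) it bounds a diagram with at most that many
faces.

The topology is done with permutations. Each surgery multiplies the face permutation, and with it
the vertex permutation, by one transposition, which merges two cycles or splits one. The Jordan
curve theorem is replaced by the genus inequality `V + F ≤ E + 2C`, with `C` the number of
components: in the planar case an edge with the same face on both sides must be a bridge. -/

open Equiv Equiv.Perm

/-! ### Equivalence relations and the number of their classes -/

section ClassCount

variable {D : Type*}

/-- The number of classes of an equivalence relation. -/
noncomputable def classCount (r : Setoid D) : ℕ := Nat.card (Quotient r)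

/-- The equivalence relation obtained from `r` by identifying the classes of `a` and `b`. -/
def Setoid.glue (r : Setoid D) (a b : D) : Setoid D where
  r x y := r x y ∨ (r x a ∧ r b y) ∨ (r x b ∧ r a y)
  iseqv := by
    refine ⟨fun x => Or.inl (r.refl x), ?_, ?_⟩
    · rintro x y (h | ⟨h, h'⟩ | ⟨h, h'⟩)
      · exact Or.inl (r.symm h)
      · exact Or.inr (Or.inr ⟨r.symm h', r.symm h⟩)
      · exact Or.inr (Or.inl ⟨r.symm h', r.symm h⟩)
    · rintro x y z (h | ⟨h, h'⟩ | ⟨h, h'⟩) (k | ⟨k, k'⟩ | ⟨k, k'⟩)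
      · exact Or.inl (r.trans h k)
      · exact Or.inr (Or.inl ⟨r.trans h k, k'⟩)
      · exact Or.inr (Or.inr ⟨r.trans h k, k'⟩)
      · exact Or.inr (Or.inl ⟨h, r.trans h' k⟩)
      · exact Or.inr (Or.inl ⟨h, k'⟩)
      · exact Or.inl (r.trans h k')
      · exact Or.inr (Or.inr ⟨h, r.trans h' k⟩)
      · exact Or.inl (r.trans h k')
      · exact Or.inr (Or.inr ⟨h, k'⟩)

theorem Setoid.glue_le_iff {r s : Setoid D} {a b : D} :
    r.glue a b ≤ s ↔ r ≤ s ∧ s a b := by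
  constructor
  · intro h
    exact ⟨fun x y hxy => h (Or.inl hxy), h (Or.inr (Or.inl ⟨r.refl a, r.refl b⟩))⟩
  · rintro ⟨h, hab⟩ x y (k | ⟨k, k'⟩ | ⟨k, k'⟩)
    · exact h k
    · exact s.trans (h k) (s.trans hab (h k'))
    · exact s.trans (h k) (s.trans (s.symm hab) (h k'))

theorem Setoid.le_glue (r : Setoid D) (a b : D) : r ≤ r.glue a b :=
  (Setoid.glue_le_iff.1 le_rfl).1

theorem Setoid.glue_rel (r : Setoid D) (a b : D) : r.glue a b a b :=
  (Setoid.glue_le_iff.1 le_rfl).2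

theorem Setoid.glue_eq_self {r : Setoid D} {a b : D} (h : r a b) : r.glue a b = r :=
  le_antisymm (Setoid.glue_le_iff.2 ⟨le_rfl, h⟩) (r.le_glue a b)

theorem classCount_glue [Finite D] {r : Setoid D} {a b : D} (h : ¬ r a b) :
    classCount r = classCount (r.glue a b) + 1 := by
  classical
  let f : {q : Quotient r // q ≠ Quotient.mk r b} → Quotient (r.glue a b) := fun q =>
    Quotient.map' (s₁ := r) (s₂ := r.glue a b) id (fun x y hxy => r.le_glue a b hxy) q.1
  have hf : Function.Bijective f := by
    constructor
    · rintro ⟨q, hq⟩ ⟨q', hq'⟩ heq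
      induction q using Quotient.inductionOn with | _ x => ?_
      induction q' using Quotient.inductionOn with | _ y => ?_
      have hx : ¬ r x b := fun h => hq (Quotient.sound h)
      have hy : ¬ r y b := fun h => hq' (Quotient.sound h)
      have : r.glue a b x y := Quotient.exact heq
      rcases this with k | ⟨_, k⟩ | ⟨k, _⟩
      · exact Subtype.ext (Quotient.sound k)
      · exact absurd (r.symm k) hy
      · exact absurd k hx
    · intro q
      induction q using Quotient.inductionOn with | _ x => ?_
      by_cases hx : r x b
      · refine ⟨⟨Quotient.mk r a, fun e => h (Quotient.exact e)⟩, ?_⟩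
        exact Quotient.sound (Or.inr (Or.inl ⟨r.refl a, r.symm hx⟩))
      · exact ⟨⟨Quotient.mk r x, fun e => hx (Quotient.exact e)⟩, rfl⟩
  have h1 := Nat.card_eq_of_bijective f hf
  have h2 : Nat.card (Option {q : Quotient r // q ≠ Quotient.mk r b}) = Nat.card (Quotient r) :=
    Nat.card_congr (Equiv.optionSubtypeNe (Quotient.mk r b))
  rw [Finite.card_option] at h2
  unfold classCount
  omega

theorem classCount_le_card [Finite D] (r : Setoid D) : classCount r ≤ Nat.card D :=
  Nat.card_le_card_of_surjective _ (Quotient.mk_surjective (s := r))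

theorem classCount_glue_le [Finite D] (r : Setoid D) (a b : D) :
    classCount r ≤ classCount (r.glue a b) + 1 := by
  by_cases h : r a b
  · rw [Setoid.glue_eq_self h]; omega
  · rw [classCount_glue h]

end ClassCount

/-! ### Cycles of a permutation multiplied by a transposition -/

section Cycles

variable {D : Type*}

/-- The relation of lying on a common cycle of the permutation `σ`. -/
abbrev cycleSetoid (σ : Perm D) : Setoid D := SameCycle.setoid σ

/-- The number of cycles of `σ`, fixed points included. -/
noncomputable abbrev cycleCount (σ : Perm D) : ℕ := classCount (cycleSetoid σ)

/-- Containment is tested on single steps of `σ`; this keeps all later comparisons of cycles and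
components local. -/
theorem cycleSetoid_le_iff {σ : Perm D} {s : Setoid D} :
    cycleSetoid σ ≤ s ↔ ∀ x, s x (σ x) := by
  constructor
  · intro h x
    exact h ((SameCycle.refl σ x).apply_right)
  · rintro h x y ⟨i, rfl⟩
    have hn : ∀ (n : ℕ) x, s x ((σ ^ n) x) := by
      intro n
      induction n with
      | zero => intro x; exact s.refl x
      | succ n ih =>
        intro x
        rw [pow_succ', Perm.mul_apply]
        exact s.trans (ih x) (h _)
    obtain ⟨n, rfl | rfl⟩ := i.eq_nat_or_neg
    · exact hn n x
    · have := hn n ((σ ^ (-(n : ℤ))) x)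
      rw [← zpow_natCast, ← Perm.mul_apply, ← zpow_add] at this
      simpa using s.symm this

variable [DecidableEq D]

/-- The transposition only exchanges the images `a` and `b`, which is invisible once these are
identified. -/
theorem glue_cycleSetoid_swap_le (σ : Perm D) (a b : D) :
    (cycleSetoid (swap a b * σ)).glue a b ≤ (cycleSetoid σ).glue a b := by
  refine Setoid.glue_le_iff.2 ⟨cycleSetoid_le_iff.2 fun x => ?_, Setoid.glue_rel _ _ _⟩
  have h1 : (cycleSetoid σ).glue a b x (σ x) :=
    Setoid.le_glue _ _ _ ((SameCycle.refl σ x).apply_right)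
  refine Setoid.trans' _ h1 ?_
  rw [Perm.mul_apply]
  by_cases ha : σ x = a
  · rw [ha, swap_apply_left]; exact Setoid.glue_rel _ _ _
  by_cases hb : σ x = b
  · rw [hb, swap_apply_right]; exact Setoid.symm' _ (Setoid.glue_rel _ _ _)
  rw [swap_apply_of_ne_of_ne ha hb]

theorem glue_cycleSetoid_swap (σ : Perm D) (a b : D) :
    (cycleSetoid (swap a b * σ)).glue a b = (cycleSetoid σ).glue a b := by
  refine le_antisymm (glue_cycleSetoid_swap_le σ a b) ?_
  have := glue_cycleSetoid_swap_le (swap a b * σ) a b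
  rwa [← mul_assoc, swap_mul_self, one_mul] at this

/-- Before its first return to `a` the orbit of `a` meets neither `a` nor `b` again, so it is
unchanged; the returning step is redirected to `b`. -/
theorem sameCycle_swap_mul [Finite D] {σ : Perm D} {a b : D} (h : ¬ SameCycle σ a b) :
    SameCycle (swap a b * σ) a b := by
  have hper : ∃ k, 0 < k ∧ (σ ^ k) a = a := by
    refine ⟨orderOf σ, orderOf_pos σ, by rw [pow_orderOf_eq_one]; rfl⟩
  classical
  let k := Nat.find hper
  obtain ⟨hk, hka⟩ : 0 < k ∧ (σ ^ k) a = a := Nat.find_spec hper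
  have key : ∀ i < k, ((swap a b * σ) ^ i) a = (σ ^ i) a := by
    intro i
    induction i with
    | zero => intro _; rfl
    | succ i ih =>
      intro hi
      rw [pow_succ', Perm.mul_apply, ih (by omega), Perm.mul_apply, ← Perm.mul_apply σ, ← pow_succ',
        swap_apply_of_ne_of_ne]
      · intro e; exact Nat.find_min hper hi ⟨Nat.succ_pos i, e⟩
      · intro e; exact h ⟨((i + 1 : ℕ) : ℤ), by rw [zpow_natCast]; exact e⟩
  refine ⟨(k : ℤ), ?_⟩
  obtain ⟨j, hj⟩ : ∃ j, k = j + 1 := ⟨k - 1, by omega⟩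
  rw [zpow_natCast, hj, pow_succ', Perm.mul_apply, key j (by omega), Perm.mul_apply,
    ← Perm.mul_apply σ, ← pow_succ', ← hj, hka, swap_apply_left]

/-- The stretch of the cycle from `a` up to its first arrival at `b` is closed by the transposition
into a cycle that misses `b`. -/
theorem not_sameCycle_swap_mul [Finite D] {σ : Perm D} {a b : D} (hab : a ≠ b)
    (h : SameCycle σ a b) : ¬ SameCycle (swap a b * σ) a b := by
  classical
  have hex : ∃ k, (σ ^ k) a = b := by
    obtain ⟨k, -, hk⟩ := h.exists_pow_eq'
    exact ⟨k, hk⟩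
  let k := Nat.find hex
  have hka : (σ ^ k) a = b := Nat.find_spec hex
  have hk : 0 < k := by
    rcases Nat.eq_zero_or_pos k with h0 | h0
    · rw [h0] at hka; exact absurd hka hab
    · exact h0
  have key : ∀ i < k, ((swap a b * σ) ^ i) a = (σ ^ i) a := by
    intro i
    induction i with
    | zero => intro _; rfl
    | succ i ih =>
      intro hi
      rw [pow_succ', Perm.mul_apply, ih (by omega), Perm.mul_apply, ← Perm.mul_apply σ, ← pow_succ',
        swap_apply_of_ne_of_ne]
      · intro e
        refine Nat.find_min hex (m := k - (i + 1)) (by omega) ?_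
        have h2 : (σ ^ (k - (i + 1) + (i + 1))) a = b := by
          rw [Nat.sub_add_cancel (by omega)]; exact hka
        rwa [pow_add, Perm.mul_apply, e] at h2
      · intro e; exact Nat.find_min hex hi e
  have hret : ((swap a b * σ) ^ k) a = a := by
    obtain ⟨j, hj⟩ : ∃ j, k = j + 1 := ⟨k - 1, by omega⟩
    rw [hj, pow_succ', Perm.mul_apply, key j (by omega), Perm.mul_apply,
      ← Perm.mul_apply σ, ← pow_succ', ← hj, hka, swap_apply_right]
  intro hs
  obtain ⟨j, -, hj⟩ := hs.exists_pow_eq'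
  have hmul : ∀ m : ℕ, ((swap a b * σ) ^ (k * m)) a = a := by
    intro m
    induction m with
    | zero => rfl
    | succ m ih => rw [Nat.mul_succ, pow_add, Perm.mul_apply, hret, ih]
  rw [← Nat.mod_add_div j k, pow_add, Perm.mul_apply, hmul, key _ (Nat.mod_lt _ hk)] at hj
  exact Nat.find_min hex (Nat.mod_lt _ hk) hj

theorem cycleSetoid_swap_mul_of_not [Finite D] {σ : Perm D} {a b : D} (h : ¬ SameCycle σ a b) :
    cycleSetoid (swap a b * σ) = (cycleSetoid σ).glue a b := by
  rw [← glue_cycleSetoid_swap, Setoid.glue_eq_self (sameCycle_swap_mul h)]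

theorem cycleCount_swap_mul_of_not [Finite D] {σ : Perm D} {a b : D} (h : ¬ SameCycle σ a b) :
    cycleCount σ = cycleCount (swap a b * σ) + 1 := by
  rw [cycleCount, cycleCount, cycleSetoid_swap_mul_of_not h, classCount_glue h]

theorem cycleSetoid_glue_of_sameCycle [Finite D] {σ : Perm D} {a b : D}
    (h : SameCycle σ a b) : (cycleSetoid (swap a b * σ)).glue a b = cycleSetoid σ := by
  rw [glue_cycleSetoid_swap, Setoid.glue_eq_self h]

theorem cycleCount_swap_mul_of_sameCycle [Finite D] {σ : Perm D} {a b : D} (hab : a ≠ b)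
    (h : SameCycle σ a b) : cycleCount (swap a b * σ) = cycleCount σ + 1 := by
  rw [cycleCount, cycleCount, ← cycleSetoid_glue_of_sameCycle h,
    classCount_glue (not_sameCycle_swap_mul hab h)]

end Cycles

/-! ### Counting classes on parts of a set -/

theorem classCount_eq_add {A B D : Type*} [Finite A] [Finite B] (r : Setoid D) (f : A → D)
    (g : B → D) (hfg : ∀ a b, ¬ r (f a) (g b))
    (hsurj : ∀ d, (∃ a, r (f a) d) ∨ ∃ b, r (g b) d) :
    classCount r = classCount (r.comap f) + classCount (r.comap g) := by
  let F : Quotient (r.comap f) ⊕ Quotient (r.comap g) → Quotient r :=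
    Sum.elim (Quotient.map' (s₁ := r.comap f) (s₂ := r) f (fun _ _ h => h))
      (Quotient.map' (s₁ := r.comap g) (s₂ := r) g (fun _ _ h => h))
  have hF : Function.Bijective F := by
    constructor
    · rintro (q | q) (q' | q') h <;> induction q using Quotient.inductionOn with | _ x => ?_ <;>
        induction q' using Quotient.inductionOn with | _ y => ?_
      · exact congrArg Sum.inl (Quotient.sound (Quotient.exact h : r (f x) (f y)))
      · exact absurd (Quotient.exact h) (hfg x y)
      · exact absurd (r.symm (Quotient.exact h)) (hfg y x)
      · exact congrArg Sum.inr (Quotient.sound (Quotient.exact h : r (g x) (g y)))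
    · intro q
      induction q using Quotient.inductionOn with | _ d => ?_
      rcases hsurj d with ⟨a, ha⟩ | ⟨b, hb⟩
      · exact ⟨Sum.inl (Quotient.mk _ a), Quotient.sound ha⟩
      · exact ⟨Sum.inr (Quotient.mk _ b), Quotient.sound hb⟩
  unfold classCount
  rw [← Nat.card_eq_of_bijective F hF, Nat.card_sum]

section Restrict

variable {D : Type*}

/-- The number of classes of `r` that meet `S`. -/
noncomputable def classCountOn (r : Setoid D) (S : Set D) : ℕ :=
  classCount (r.comap (Subtype.val : S → D))

theorem classCountOn_glue [Finite D] {r : Setoid D} {a b : D} {S : Set D} (h : ¬ r a b)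
    (ha : a ∈ S) (hb : b ∈ S) : classCountOn r S = classCountOn (r.glue a b) S + 1 :=
  classCount_glue (r := r.comap (Subtype.val : S → D)) (a := ⟨a, ha⟩) (b := ⟨b, hb⟩) h

theorem classCountOn_union [Finite D] {r : Setoid D} {S T : Set D}
    (h : ∀ x ∈ S, ∀ y ∈ T, ¬ r x y) :
    classCountOn r (S ∪ T) = classCountOn r S + classCountOn r T := by
  refine classCount_eq_add (r.comap (Subtype.val : ↥(S ∪ T) → D))
    (Set.inclusion Set.subset_union_left) (Set.inclusion Set.subset_union_right) ?_ ?_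
  · rintro ⟨x, hx⟩ ⟨y, hy⟩
    exact h x hx y hy
  · rintro ⟨x, hx | hx⟩
    · exact Or.inl ⟨⟨x, hx⟩, r.refl x⟩
    · exact Or.inr ⟨⟨x, hx⟩, r.refl x⟩

theorem classCountOn_univ (r : Setoid D) : classCountOn r Set.univ = classCount r :=
  Nat.card_congr
    { toFun := Quotient.map' (s₁ := r.comap _) (s₂ := r) Subtype.val (fun _ _ h => h)
      invFun := Quotient.map' (s₁ := r) (s₂ := r.comap _) (fun x => ⟨x, trivial⟩) (fun _ _ h => h)
      left_inv := fun q => by induction q using Quotient.inductionOn; rfl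
      right_inv := fun q => by induction q using Quotient.inductionOn; rfl }

theorem classCountOn_pair [Finite D] {r : Setoid D} {a b : D} (h : ¬ r a b) :
    classCountOn r {a, b} = 2 := by
  have h1 : ∀ c : D, classCountOn r {c} = 1 := fun c => by
    unfold classCountOn classCount
    have : Subsingleton (Quotient (r.comap (Subtype.val : ({c} : Set D) → D))) :=
      ⟨fun p q => by
        induction p using Quotient.inductionOn with | _ x => ?_
        induction q using Quotient.inductionOn with | _ y => ?_
        obtain ⟨x, rfl⟩ := x
        obtain ⟨y, rfl⟩ := y
        rfl⟩
    have : Nonempty (Quotient (r.comap (Subtype.val : ({c} : Set D) → D))) :=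
      ⟨Quotient.mk _ ⟨c, rfl⟩⟩
    exact Nat.card_unique
  rw [Set.insert_eq, classCountOn_union, h1, h1]
  rintro x rfl y rfl
  exact h

end Restrict

/-! ### Explicit traversals of cycles -/

section Walks

variable {D : Type*}

/-- Starting at `x` and applying `σ` repeatedly one passes through the elements of the list and then
arrives at `y`. -/
def IsWalk (σ : Perm D) : D → List D → D → Prop
  | x, [], y => x = y
  | x, z :: l, y => x = z ∧ IsWalk σ (σ x) l y

theorem IsWalk.append {σ : Perm D} {x y z : D} {l l' : List D} (h : IsWalk σ x l y)
    (h' : IsWalk σ y l' z) : IsWalk σ x (l ++ l') z := by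
  induction l generalizing x with
  | nil => cases h; exact h'
  | cons a l ih => exact ⟨h.1, ih h.2⟩

theorem isWalk_append {σ : Perm D} {x z : D} {l l' : List D} :
    IsWalk σ x (l ++ l') z ↔ ∃ y, IsWalk σ x l y ∧ IsWalk σ y l' z := by
  refine ⟨fun h => ?_, fun ⟨y, h, h'⟩ => h.append h'⟩
  induction l generalizing x with
  | nil => exact ⟨x, rfl, h⟩
  | cons a l ih =>
    obtain ⟨y, h1, h2⟩ := ih h.2
    exact ⟨y, ⟨h.1, h1⟩, h2⟩

theorem IsWalk.of_forall {σ τ : Perm D} {x y : D} {l : List D} (h : IsWalk σ x l y)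
    (hl : ∀ z ∈ l, τ z = σ z) : IsWalk τ x l y := by
  induction l generalizing x with
  | nil => exact h
  | cons a l ih =>
    obtain ⟨rfl, h⟩ := h
    refine ⟨rfl, ?_⟩
    rw [hl x (by simp)]
    exact ih h fun z hz => hl z (by simp [hz])

theorem IsWalk.swap_mul [DecidableEq D] {σ : Perm D} {a b x y : D} {l : List D}
    (h : IsWalk σ x l y) (hl : ∀ z ∈ l, σ z ≠ a ∧ σ z ≠ b) : IsWalk (swap a b * σ) x l y :=
  h.of_forall fun z hz => swap_apply_of_ne_of_ne (hl z hz).1 (hl z hz).2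

/-- Along the walk the image `b` occurs only at the last step and `a` never, so just the last step
is redirected. -/
theorem IsWalk.swap_mul_of_end [DecidableEq D] {σ : Perm D} {a b x : D} {l : List D}
    (h : IsWalk σ x (x :: l) b) (hb : b ∉ l) (ha : ∀ z ∈ x :: l, σ z ≠ a) :
    IsWalk (swap a b * σ) x (x :: l) a := by
  induction l generalizing x with
  | nil =>
    have h2 : σ x = b := h.2
    refine ⟨rfl, ?_⟩
    change swap a b (σ x) = a
    rw [h2, swap_apply_right]
  | cons z l ih =>
    obtain ⟨-, rfl, h⟩ := h
    refine ⟨rfl, ?_⟩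
    have : (swap a b * σ) x = σ x :=
      swap_apply_of_ne_of_ne (ha x (by simp)) (fun e => hb (by simp [e]))
    rw [this]
    exact ih ⟨rfl, h⟩ (fun e => hb (by simp [e])) fun z hz => ha z (by simp [hz])

theorem IsWalk.apply_mem {σ : Perm D} {x y : D} {l : List D} (h : IsWalk σ x (x :: l) y) {z : D}
    (hz : z ∈ x :: l) : σ z ∈ l ∨ σ z = y := by
  induction l generalizing x with
  | nil =>
    obtain rfl : z = x := by simpa using hz
    exact Or.inr h.2
  | cons a l ih =>
    obtain ⟨-, rfl, h⟩ := h
    rcases List.mem_cons.1 hz with rfl | hz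
    · exact Or.inl (by simp)
    · rcases ih ⟨rfl, h⟩ hz with h | h
      · exact Or.inl (by simp [h])
      · exact Or.inr h

theorem IsWalk.iterate (σ : Perm D) (x : D) (n : ℕ) :
    IsWalk σ x (List.iterate σ x n) ((σ ^ n) x) := by
  induction n generalizing x with
  | zero => rfl
  | succ n ih =>
    refine ⟨rfl, ?_⟩
    rw [pow_succ, Perm.mul_apply]
    exact ih (σ x)

theorem IsWalk.eq_iterate {σ : Perm D} {x y : D} {l : List D} (h : IsWalk σ x l y) :
    l = List.iterate σ x l.length ∧ (σ ^ l.length) x = y := by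
  induction l generalizing x with
  | nil => exact ⟨rfl, h⟩
  | cons a l ih =>
    obtain ⟨rfl, h⟩ := h
    obtain ⟨h1, h2⟩ := ih h
    refine ⟨by rw [List.length_cons, List.iterate]; exact congrArg _ h1, ?_⟩
    rw [List.length_cons, pow_succ, Perm.mul_apply]
    exact h2

/-- The list runs once around the cycle of `σ` through `x`, starting at `x`. -/
structure IsCycleList (σ : Perm D) (x : D) (l : List D) : Prop where
  walk : IsWalk σ x l x
  nodup : l.Nodup
  ne_nil : l ≠ []

theorem IsCycleList.exists_cons {σ : Perm D} {x : D} {l : List D} (h : IsCycleList σ x l) :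
    ∃ t, l = x :: t := by
  obtain ⟨hw, -, hne⟩ := h
  cases l with
  | nil => exact absurd rfl hne
  | cons a l => obtain ⟨rfl, -⟩ := hw; exact ⟨l, rfl⟩

theorem IsCycleList.mem_iff {σ : Perm D} {x : D} {l : List D} (h : IsCycleList σ x l) {y : D} :
    y ∈ l ↔ SameCycle σ x y := by
  obtain ⟨t, rfl⟩ := h.exists_cons
  constructor
  · intro hy
    have key : ∀ (l : List D) (u v : D), IsWalk σ u l v → y ∈ l → SameCycle σ u y := by
      intro l
      induction l with
      | nil => intro u v _ hy; simp at hy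
      | cons a l ih =>
        rintro u v ⟨rfl, h⟩ hy
        rcases List.mem_cons.1 hy with rfl | hy
        · exact SameCycle.refl _ _
        · exact sameCycle_apply_left.1 (ih _ _ h hy)
    exact key _ _ _ h.walk hy
  · intro hs
    have hstep : ∀ z ∈ x :: t, σ z ∈ x :: t := fun z hz => by
      rcases h.walk.apply_mem hz with h | h <;> simp [h]
    have hl : (x :: t).length ≠ 0 := by simp
    have hfix : (σ ^ (x :: t).length) x = x := h.walk.eq_iterate.2
    obtain ⟨i, rfl⟩ := hs
    have hpow : ∀ n : ℕ, (σ ^ n) x ∈ x :: t := by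
      intro n
      induction n with
      | zero => simp
      | succ n ih => rw [pow_succ', Perm.mul_apply]; exact hstep _ ih
    -- The power of `σ` given by the length of the list fixes `x`, so a multiple of the length can
    -- be added to make the exponent non-negative.
    obtain ⟨m, hm⟩ : ∃ m : ℕ, 0 ≤ i + ((x :: t).length : ℤ) * m := by
      refine ⟨i.natAbs, ?_⟩
      have h1 : (1 : ℤ) ≤ ((x :: t).length : ℤ) := by
        rw [List.length_cons]; push_cast; linarith [Int.natCast_nonneg t.length]
      have h2 : -i ≤ (i.natAbs : ℤ) := by omega
      have h3 : (0 : ℤ) ≤ i.natAbs := by omega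
      nlinarith
    have hfix' : (σ ^ (((x :: t).length : ℤ) * m)) x = x := by
      rw [zpow_mul, zpow_natCast, zpow_natCast]
      have : ∀ k : ℕ, ((σ ^ (x :: t).length) ^ k) x = x := fun k => by
        induction k with
        | zero => rfl
        | succ k ih => rw [pow_succ, Perm.mul_apply, hfix, ih]
      exact this m
    have := hpow (i + ((x :: t).length : ℤ) * m).toNat
    rwa [← zpow_natCast, Int.toNat_of_nonneg hm, zpow_add, Perm.mul_apply, hfix'] at this

theorem IsCycleList.swap_mul [DecidableEq D] {σ : Perm D} {a b x : D} {l : List D}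
    (h : IsCycleList σ x l) (ha : ¬ SameCycle σ x a) (hb : ¬ SameCycle σ x b) :
    IsCycleList (swap a b * σ) x l := by
  refine ⟨h.walk.swap_mul fun z hz => ?_, h.nodup, h.ne_nil⟩
  rw [h.mem_iff] at hz
  exact ⟨fun e => ha (e ▸ hz.apply_right), fun e => hb (e ▸ hz.apply_right)⟩

theorem isCycleList_iterate [Finite D] (σ : Perm D) (x : D) :
    IsCycleList σ x (List.iterate σ x (Function.minimalPeriod σ x)) := by
  have hpos : 0 < Function.minimalPeriod σ x := by
    refine Function.minimalPeriod_pos_of_mem_periodicPts ?_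
    exact ⟨orderOf σ, orderOf_pos σ, by
      rw [Function.IsPeriodicPt, Function.IsFixedPt, ← Perm.coe_pow, pow_orderOf_eq_one]; rfl⟩
  have hfix : (σ ^ Function.minimalPeriod σ x) x = x := by
    have := Function.iterate_minimalPeriod (f := σ) (x := x)
    rwa [← Perm.coe_pow] at this
  refine ⟨?_, ?_, ?_⟩
  · have := IsWalk.iterate σ x (Function.minimalPeriod σ x)
    rwa [hfix] at this
  · rw [List.nodup_iff_injective_getElem]
    rintro ⟨i, hi⟩ ⟨j, hj⟩ h
    simp only [List.getElem_iterate, Fin.mk.injEq] at h ⊢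
    rw [List.length_iterate] at hi hj
    exact Function.iterate_injOn_Iio_minimalPeriod hi hj h
  · intro h
    have := congrArg List.length h
    rw [List.length_iterate, List.length_nil] at this
    omega

/-- This allows cycle labels, defined through minimal periods, to be read off from any explicit
traversal. -/
theorem IsCycleList.eq_iterate [Finite D] {σ : Perm D} {x : D} {l : List D}
    (h : IsCycleList σ x l) : l = List.iterate σ x (Function.minimalPeriod σ x) := by
  have h' := isCycleList_iterate σ x
  have hlen : l.length = (List.iterate σ x (Function.minimalPeriod σ x)).length := by
    refine List.Perm.length_eq ((List.perm_ext_iff_of_nodup h.nodup h'.nodup).2 fun y => ?_)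
    rw [h.mem_iff, h'.mem_iff]
  rw [List.length_iterate] at hlen
  rw [← hlen]
  exact h.walk.eq_iterate.1

end Walks

/-! ### Combinatorial maps: detaching an edge, and the genus inequality -/

section Peel

variable {E : Type}

@[simp] theorem reverseEdge_apply (d : E × Bool) : reverseEdge E d = (d.1, !d.2) := rfl

theorem reverseEdge_reverseEdge (d : E × Bool) : reverseEdge E (reverseEdge E d) = d := by simp

theorem reverseEdge_ne (d : E × Bool) : reverseEdge E d ≠ d := by
  intro h
  have := congrArg Prod.snd h
  simp at this

theorem reverseEdge_mul_self : reverseEdge E * reverseEdge E = 1 :=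
  Equiv.ext reverseEdge_reverseEdge

/-- The permutation that turns an oriented edge around its origin. -/
abbrev vertexPerm (φ : Perm (E × Bool)) : Perm (E × Bool) := φ * reverseEdge E

/-- The relation of lying in the same connected component of a combinatorial map. -/
def compSetoid (φ : Perm (E × Bool)) : Setoid (E × Bool) :=
  cycleSetoid φ ⊔ cycleSetoid (reverseEdge E)

theorem compSetoid_le_iff {φ : Perm (E × Bool)} {s : Setoid (E × Bool)} :
    compSetoid φ ≤ s ↔ (∀ x, s x (φ x)) ∧ ∀ x, s x (reverseEdge E x) := by
  rw [compSetoid, sup_le_iff, cycleSetoid_le_iff, cycleSetoid_le_iff]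

theorem compSetoid_apply_right (φ : Perm (E × Bool)) (x : E × Bool) :
    compSetoid φ x (φ x) := (compSetoid_le_iff.1 le_rfl).1 x

theorem compSetoid_reverseEdge (φ : Perm (E × Bool)) (x : E × Bool) :
    compSetoid φ x (reverseEdge E x) := (compSetoid_le_iff.1 le_rfl).2 x

theorem cycleSetoid_le_compSetoid (φ : Perm (E × Bool)) : cycleSetoid φ ≤ compSetoid φ :=
  le_sup_left

theorem cycleSetoid_vertexPerm_le_compSetoid (φ : Perm (E × Bool)) :
    cycleSetoid (vertexPerm φ) ≤ compSetoid φ :=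
  cycleSetoid_le_iff.2 fun x =>
    (compSetoid φ).trans (compSetoid_reverseEdge φ x) (compSetoid_apply_right φ _)

/-- A combinatorial map all of whose components are spherical. -/
def IsPlanarMap (φ : Perm (E × Bool)) : Prop :=
  cycleCount φ + cycleCount (vertexPerm φ) = Nat.card E + 2 * classCount (compSetoid φ)

variable [DecidableEq E]

/-- Detach the terminal end of the oriented edge `d` from its vertex. -/
def detach (φ : Perm (E × Bool)) (d : E × Bool) : Perm (E × Bool) :=
  swap (φ d) (reverseEdge E d) * φ

theorem detach_apply_self (φ : Perm (E × Bool)) (d : E × Bool) :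
    detach φ d d = reverseEdge E d := swap_apply_left _ _

theorem glue_compSetoid_swap_mul (φ : Perm (E × Bool)) (a b : E × Bool) :
    (compSetoid (swap a b * φ)).glue a b = (compSetoid φ).glue a b := by
  have key : ∀ φ : Perm (E × Bool),
      (compSetoid (swap a b * φ)).glue a b ≤ (compSetoid φ).glue a b := by
    intro φ
    refine Setoid.glue_le_iff.2 ⟨compSetoid_le_iff.2 ⟨?_, ?_⟩, Setoid.glue_rel _ _ _⟩
    · have h1 : (cycleSetoid φ).glue a b ≤ (compSetoid φ).glue a b :=
        Setoid.glue_le_iff.2 ⟨(cycleSetoid_le_compSetoid φ).trans (Setoid.le_glue _ _ _),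
          Setoid.glue_rel _ _ _⟩
      have h2 := (Setoid.le_glue _ a b).trans ((glue_cycleSetoid_swap_le φ a b).trans h1)
      exact cycleSetoid_le_iff.1 h2
    · exact fun x => Setoid.le_glue _ _ _ (compSetoid_reverseEdge φ x)
  refine le_antisymm (key φ) ?_
  have := key (swap a b * φ)
  rwa [← mul_assoc, swap_mul_self, one_mul] at this

theorem glue_compSetoid_detach (φ : Perm (E × Bool)) (d : E × Bool) :
    (compSetoid (detach φ d)).glue (φ d) (reverseEdge E d) = compSetoid φ := by
  rw [detach, glue_compSetoid_swap_mul, Setoid.glue_eq_self]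
  exact (compSetoid φ).trans ((compSetoid φ).symm (compSetoid_apply_right φ d))
    (compSetoid_reverseEdge φ d)

omit [DecidableEq E] in
theorem sameCycle_vertexPerm (φ : Perm (E × Bool)) (d : E × Bool) :
    SameCycle (vertexPerm φ) (φ d) (reverseEdge E d) := by
  have : vertexPerm φ (reverseEdge E d) = φ d := by
    rw [Perm.mul_apply, reverseEdge_reverseEdge]
  rw [← this]
  exact sameCycle_apply_left.2 (SameCycle.refl _ _)

/-- Faces and vertices undergo the same transposition. It makes `reverseEdge E d` a fixed point of
the vertex permutation, that is, a vertex of degree one. -/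
theorem vertexPerm_detach (φ : Perm (E × Bool)) (d : E × Bool) :
    vertexPerm (detach φ d) = swap (φ d) (reverseEdge E d) * vertexPerm φ := mul_assoc _ _ _

variable [Finite E] {φ : Perm (E × Bool)} {d : E × Bool}

theorem cycleCount_vertexPerm_detach (h : φ d ≠ reverseEdge E d) :
    cycleCount (vertexPerm (detach φ d)) = cycleCount (vertexPerm φ) + 1 := by
  rw [vertexPerm_detach]
  exact cycleCount_swap_mul_of_sameCycle h (sameCycle_vertexPerm φ d)

theorem cycleCount_detach_of_sameCycle (h : φ d ≠ reverseEdge E d)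
    (hs : SameCycle φ d (reverseEdge E d)) :
    cycleCount (detach φ d) = cycleCount φ + 1 :=
  cycleCount_swap_mul_of_sameCycle h (sameCycle_apply_left.2 hs)

theorem cycleCount_detach_of_not (hs : ¬ SameCycle φ d (reverseEdge E d)) :
    cycleCount φ = cycleCount (detach φ d) + 1 :=
  cycleCount_swap_mul_of_not fun h => hs (sameCycle_apply_left.1 h)

theorem compSetoid_detach_of_not (hs : ¬ SameCycle φ d (reverseEdge E d)) :
    compSetoid (detach φ d) = compSetoid φ := by
  conv_rhs => rw [← glue_compSetoid_detach φ d]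
  rw [Setoid.glue_eq_self]
  exact cycleSetoid_le_compSetoid _ (sameCycle_swap_mul fun h => hs (sameCycle_apply_left.1 h))

theorem classCount_compSetoid_detach_le :
    classCount (compSetoid (detach φ d)) ≤ classCount (compSetoid φ) + 1 := by
  conv_rhs => rw [← glue_compSetoid_detach φ d]
  exact classCount_glue_le _ _ _

theorem classCount_bot {D : Type*} : classCount (⊥ : Setoid D) = Nat.card D :=
  (Nat.card_eq_of_bijective (Quotient.mk (⊥ : Setoid D))
    ⟨fun _ _ h => Quotient.exact h, Quotient.mk_surjective⟩).symm

omit [Finite E] [DecidableEq E] in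
theorem reverseEdge_sameCycle_iff {x y : E × Bool} :
    SameCycle (reverseEdge E) x y ↔ x.1 = y.1 := by
  constructor
  · intro h
    have hle : cycleSetoid (reverseEdge E) ≤ Setoid.ker Prod.fst :=
      cycleSetoid_le_iff.2 fun x => rfl
    exact hle h
  · rcases x with ⟨e, b⟩
    rcases y with ⟨f, c⟩
    rintro ⟨rfl : e = f⟩
    by_cases hbc : b = c
    · rw [hbc]
    · refine ⟨1, ?_⟩
      cases b <;> cases c <;> simp_all

omit [DecidableEq E] [Finite E] in
theorem cycleCount_reverseEdge : cycleCount (reverseEdge E) = Nat.card E := by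
  refine Nat.card_congr
    { toFun := Quotient.lift Prod.fst fun x y h => reverseEdge_sameCycle_iff.1 h
      invFun := fun e => Quotient.mk _ (e, true)
      left_inv := fun q => ?_
      right_inv := fun e => rfl }
  induction q using Quotient.inductionOn with | _ x => ?_
  exact Quotient.sound (reverseEdge_sameCycle_iff.2 rfl)

/-- The genus of a combinatorial map is not negative. -/
theorem cycleCount_add_cycleCount_le (φ : Perm (E × Bool)) :
    cycleCount φ + cycleCount (vertexPerm φ) ≤ Nat.card E + 2 * classCount (compSetoid φ) := by
  -- Detaching adds a vertex. Either it also adds a face and at most one component, or it removes a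
  -- face and keeps the components; in both cases the bound for the new map gives that for the old.
  -- The process stops when all edges are isolated segments, where `V = 2E` and `F = C = E`.
  induction hn : Nat.card (E × Bool) - cycleCount (vertexPerm φ) using Nat.strong_induction_on
    generalizing φ with
  | _ n ih =>
    by_cases hall : ∀ d, φ d = reverseEdge E d
    · obtain rfl : φ = reverseEdge E := Equiv.ext hall
      have h1 : compSetoid (reverseEdge E) = cycleSetoid (reverseEdge E) := sup_idem _
      have h2 : cycleCount (vertexPerm (reverseEdge E)) = Nat.card E * 2 := by
        have h3 : cycleSetoid (1 : Perm (E × Bool)) = ⊥ :=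
          le_bot_iff.1 (cycleSetoid_le_iff.2 fun _ => rfl)
        rw [vertexPerm, reverseEdge_mul_self, cycleCount, h3, classCount_bot, Nat.card_prod,
          Nat.card_eq_fintype_card (α := Bool), Fintype.card_bool]
      rw [h1, h2]
      change _ ≤ _ + 2 * cycleCount _
      rw [cycleCount_reverseEdge]
      omega
    · push Not at hall
      obtain ⟨d, hd⟩ := hall
      have h1 := cycleCount_vertexPerm_detach hd
      have h2 : cycleCount (vertexPerm (detach φ d)) ≤ _ := classCount_le_card _
      have h3 := ih _ (by omega) (detach φ d) rfl
      by_cases hs : SameCycle φ d (reverseEdge E d)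
      · have h4 := cycleCount_detach_of_sameCycle hd hs
        have h5 := classCount_compSetoid_detach_le (φ := φ) (d := d)
        omega
      · have h4 := cycleCount_detach_of_not hs
        rw [compSetoid_detach_of_not hs] at h3
        omega

theorem IsPlanarMap.detach_of_not (h : IsPlanarMap φ) (hd : φ d ≠ reverseEdge E d)
    (hs : ¬ SameCycle φ d (reverseEdge E d)) : IsPlanarMap (detach φ d) := by
  have h1 := cycleCount_vertexPerm_detach hd
  have h2 := cycleCount_detach_of_not hs
  unfold IsPlanarMap at h ⊢
  rw [compSetoid_detach_of_not hs]
  omega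

/-- The combinatorial Jordan curve theorem: `V` and `F` both grow by one, so the genus inequality
forces a further component. -/
theorem IsPlanarMap.detach_of_sameCycle (h : IsPlanarMap φ) (hd : φ d ≠ reverseEdge E d)
    (hs : SameCycle φ d (reverseEdge E d)) :
    IsPlanarMap (detach φ d) ∧ ¬ compSetoid (detach φ d) (φ d) (reverseEdge E d) := by
  have h1 := cycleCount_vertexPerm_detach hd
  have h2 := cycleCount_detach_of_sameCycle hd hs
  have h3 := cycleCount_add_cycleCount_le (detach φ d)
  have h4 := classCount_compSetoid_detach_le (φ := φ) (d := d)
  unfold IsPlanarMap at h ⊢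
  refine ⟨by omega, fun hc => ?_⟩
  have h5 := glue_compSetoid_detach φ d
  rw [Setoid.glue_eq_self hc] at h5
  rw [h5] at h3
  omega

/-- The set of oriented edges in the component of `d`. -/
def component (φ : Perm (E × Bool)) (d : E × Bool) : Set (E × Bool) := {x | compSetoid φ d x}

/-- The number of vertices of the component of `d`. -/
noncomputable def vertexCount (φ : Perm (E × Bool)) (d : E × Bool) : ℕ :=
  classCountOn (cycleSetoid (vertexPerm φ)) (component φ d)

theorem classCountOn_vertexPerm_detach (hd : φ d ≠ reverseEdge E d) :
    classCountOn (cycleSetoid (vertexPerm (detach φ d))) (component φ d) =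
      vertexCount φ d + 1 := by
  have hs := sameCycle_vertexPerm φ d
  have hn := not_sameCycle_swap_mul hd hs
  rw [vertexCount, ← cycleSetoid_glue_of_sameCycle hs, ← vertexPerm_detach]
  rw [← vertexPerm_detach] at hn
  exact classCountOn_glue hn (compSetoid_apply_right φ d) (compSetoid_reverseEdge φ d)

theorem vertexCount_detach_of_not (hd : φ d ≠ reverseEdge E d)
    (hs : ¬ SameCycle φ d (reverseEdge E d)) :
    vertexCount (detach φ d) d = vertexCount φ d + 1 := by
  rw [← classCountOn_vertexPerm_detach hd, vertexCount, component, compSetoid_detach_of_not hs]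
  rfl

omit [Finite E] in
theorem component_eq_union :
    component φ d = component (detach φ d) (φ d) ∪ component (detach φ d) d := by
  have hg := glue_compSetoid_detach φ d
  have hr := compSetoid_reverseEdge (detach φ d) d
  ext x
  change compSetoid φ d x ↔ compSetoid (detach φ d) (φ d) x ∨ compSetoid (detach φ d) d x
  have hle : compSetoid (detach φ d) ≤ compSetoid φ := by
    conv_rhs => rw [← hg]
    exact Setoid.le_glue _ _ _
  constructor
  · intro hx
    rw [← hg] at hx
    rcases hx with h | ⟨-, h⟩ | ⟨-, h⟩
    · exact Or.inr h
    · exact Or.inr ((compSetoid _).trans hr h)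
    · exact Or.inl h
  · rintro (h | h)
    · exact (compSetoid φ).trans (compSetoid_apply_right φ d) (hle h)
    · exact hle h

theorem vertexCount_detach_of_sameCycle (h : IsPlanarMap φ) (hd : φ d ≠ reverseEdge E d)
    (hs : SameCycle φ d (reverseEdge E d)) :
    vertexCount (detach φ d) (φ d) + vertexCount (detach φ d) d = vertexCount φ d + 1 := by
  have hn := (h.detach_of_sameCycle hd hs).2
  have hr := compSetoid_reverseEdge (detach φ d) d
  rw [← classCountOn_vertexPerm_detach hd, component_eq_union, classCountOn_union]
  · rfl
  · intro x hx y hy hxy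
    refine hn ?_
    refine (compSetoid _).trans hx ((compSetoid _).trans ?_
      ((compSetoid _).trans ((compSetoid _).symm hy) hr))
    exact cycleSetoid_vertexPerm_le_compSetoid _ hxy

section Lists

omit [Finite E] in
-- The boundary path `d U d⁻¹ V` breaks into the loop `U` at the far end of `d` and the path `d d⁻¹
-- V`, on which `d` is a leaf.
theorem IsCycleList.detach_split {z : E × Bool} {u v : List (E × Bool)}
    (h : IsCycleList φ d (d :: (z :: u) ++ reverseEdge E d :: v)) :
    IsCycleList (detach φ d) (φ d) (z :: u) ∧
      IsCycleList (detach φ d) d (d :: reverseEdge E d :: v) := by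
  obtain ⟨hw, hnd, -⟩ := h
  obtain ⟨y, h1, hy, h2⟩ := isWalk_append.1 hw
  obtain rfl : y = reverseEdge E d := hy
  obtain ⟨-, h1⟩ := h1
  obtain rfl : φ d = z := h1.1
  simp only [List.cons_append, List.nodup_cons, List.mem_cons, List.mem_append, not_or,
    List.nodup_append] at hnd
  obtain ⟨⟨hd1, hd2, hd3, hd4⟩, ⟨ha1, ha2, ha3⟩, hu, ⟨hb, hv⟩, hdis⟩ := hnd
  have hinj : ∀ x, φ x = φ d → x = d := fun x hx => φ.injective hx
  refine ⟨⟨h1.swap_mul_of_end (fun e => hdis _ e _ (Or.inl rfl) rfl) ?_, ?_, by simp⟩,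
    ⟨⟨rfl, ?_⟩, ?_, by simp⟩⟩
  · rintro x hx e
    rcases List.mem_cons.1 hx with rfl | hx
    · exact hd1 (hinj _ e).symm
    · exact hd2 (hinj _ e ▸ hx)
  · exact List.nodup_cons.2 ⟨ha1, hu⟩
  · rw [detach_apply_self]
    have h3 : IsWalk φ (reverseEdge E d) (reverseEdge E d :: v) d := ⟨rfl, h2⟩
    refine h3.swap_mul fun x hx => ⟨fun e => ?_, fun e => ?_⟩
    · rcases List.mem_cons.1 hx with rfl | hx
      · exact hd3 (hinj _ e).symm
      · exact hd4 (hinj _ e ▸ hx)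
    · rcases h3.apply_mem hx with h | h
      · exact hb (e ▸ h)
      · exact hd3 (h.symm.trans e)
  · simp only [List.nodup_cons, List.mem_cons, not_or]
    exact ⟨⟨hd3, hd4⟩, hb, hv⟩

omit [Finite E] in
-- The two faces along `d` become one, whose boundary runs up and down the leaf `d` and then along
-- the rest of both old boundaries.
theorem IsCycleList.detach_merge {x y : List (E × Bool)} (h : IsCycleList φ d (d :: y))
    (h' : IsCycleList φ (reverseEdge E d) (reverseEdge E d :: x))
    (hs : ¬ SameCycle φ d (reverseEdge E d)) :
    IsCycleList (detach φ d) d (d :: reverseEdge E d :: (x ++ y)) := by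
  have hdis : ∀ z ∈ d :: y, z ∉ reverseEdge E d :: x := fun z hz hz' =>
    hs ((h.mem_iff.1 hz).trans (h'.mem_iff.1 hz').symm)
  have hinj : ∀ x, φ x = φ d → x = d := fun x hx => φ.injective hx
  have hnd := h.nodup
  have hnd' := h'.nodup
  rw [List.nodup_cons] at hnd hnd'
  refine ⟨⟨rfl, ?_⟩, ?_, by simp⟩
  · rw [detach_apply_self, ← List.cons_append]
    refine IsWalk.append (y := φ d) (h'.walk.swap_mul_of_end hnd'.1 fun z hz e => ?_) ?_
    · obtain rfl := hinj _ e
      exact hdis _ (by simp) hz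
    · refine h.walk.2.swap_mul fun z hz => ⟨fun e => ?_, fun e => ?_⟩
      · obtain rfl := hinj _ e
        exact hnd.1 hz
      · have h1 : φ z ∈ d :: y := by
          rw [h.mem_iff]
          exact (h.mem_iff.1 (List.mem_cons_of_mem _ hz)).apply_right
        exact hdis _ h1 (by rw [e]; simp)
  · rw [← List.cons_append, List.nodup_cons, List.nodup_append]
    refine ⟨?_, h'.nodup, hnd.2, fun a ha b hb e => ?_⟩
    · rw [List.mem_append, not_or]
      exact ⟨hdis _ (by simp), hnd.1⟩
    · exact hdis b (by simp [hb]) (e ▸ ha)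

end Lists

end Peel

/-! ### Symmetrized relators and the peeling of boundary words -/

namespace GroupPresentation

variable {α : Type*} (P : GroupPresentation α)

/-- The words obtained from the relators by cyclic shifts and inversion. -/
def symRelators : Set (List (α × Bool)) :=
  {w | ∃ R ∈ P.relators, w.IsRotated R ∨ w.IsRotated (FreeGroup.invRev R)}

theorem symRelators_of_isRotated {w w' : List (α × Bool)} (h : w ∈ P.symRelators)
    (h' : w'.IsRotated w) : w' ∈ P.symRelators := by
  obtain ⟨R, hR, h | h⟩ := h
  · exact ⟨R, hR, Or.inl (h'.trans h)⟩
  · exact ⟨R, hR, Or.inr (h'.trans h)⟩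

/-- `P.Decomposes w v f`: by successively deleting a boundary edge, a planar diagram with boundary
label `w`, with `v` vertices and `f` faces, is reduced to single vertices. The deleted edge is the
first one on the boundary path; it is a bridge or it separates a face from the outer face. -/
inductive Decomposes : List (α × Bool) → ℕ → ℕ → Prop
  | nil : Decomposes [] 1 0
  | bridge {u w : List (α × Bool)} {v₁ v₂ f₁ f₂ : ℕ} (a : α) (b : Bool) (hu : Decomposes u v₁ f₁)
      (hw : Decomposes w v₂ f₂) :
      Decomposes ((a, b) :: (u ++ (a, !b) :: w)) (v₁ + v₂) (f₁ + f₂)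
  | face {x y : List (α × Bool)} {v f : ℕ} (a : α) (b : Bool) (h : Decomposes (x ++ y) v f)
      (hx : (a, !b) :: x ∈ P.symRelators) : Decomposes ((a, b) :: y) v (f + 1)

end GroupPresentation

/-! ### Peeling a planar map -/

section Decompose

variable {α : Type*} {P : GroupPresentation α} {E : Type}

/-- The letter read along an oriented edge. -/
def dartLabel (letter : E → α) (d : E × Bool) : α × Bool := (letter d.1, d.2)

theorem IsCycleList.cycleLabel_eq [Finite E] {φ : Perm (E × Bool)} {d : E × Bool}
    {l : List (E × Bool)} (h : IsCycleList φ d l) (letter : E → α) :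
    cycleLabel letter φ d = l.map (dartLabel letter) := by
  rw [cycleLabel, ← h.eq_iterate]; rfl

/-- In the component of `d` every face except the one on the left of `d` is labelled by a
relator. -/
def IsDiscComponent (P : GroupPresentation α) (letter : E → α) (φ : Perm (E × Bool))
    (d : E × Bool) : Prop :=
  ∀ x, compSetoid φ d x → SameCycle φ d x ∨ cycleLabel letter φ x ∈ P.symRelators

variable [Finite E] [DecidableEq E] {letter : E → α} {φ : Perm (E × Bool)} {d : E × Bool}

theorem cycleLabel_detach {x : E × Bool} (h : ¬ SameCycle φ d x)
    (h' : ¬ SameCycle φ (reverseEdge E d) x) :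
    cycleLabel letter (detach φ d) x = cycleLabel letter φ x := by
  have hx := isCycleList_iterate φ x
  rw [hx.cycleLabel_eq]
  refine IsCycleList.cycleLabel_eq (hx.swap_mul (fun e => h ?_) (fun e => h' e.symm)) letter
  exact (sameCycle_apply_right.1 e).symm

omit [DecidableEq E] in
theorem exists_isCycleList_cons (φ : Perm (E × Bool)) (d : E × Bool) :
    ∃ t, IsCycleList φ d (d :: t) := by
  obtain ⟨t, ht⟩ := (isCycleList_iterate φ d).exists_cons
  exact ⟨t, ht ▸ isCycleList_iterate φ d⟩

/-- Detaching a bridge `d` whose terminal vertex carries further edges separates the component into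
two disc components. -/
theorem exists_detach_split (hp : IsPlanarMap φ) (hd : φ d ≠ reverseEdge E d)
    (hs : SameCycle φ d (reverseEdge E d)) (hdisc : IsDiscComponent P letter φ d) :
    ∃ u v, IsCycleList φ d (d :: u ++ reverseEdge E d :: v) ∧
      IsCycleList (detach φ d) (φ d) u ∧
      IsCycleList (detach φ d) d (d :: reverseEdge E d :: v) ∧
      IsDiscComponent P letter (detach φ d) (φ d) ∧
      IsDiscComponent P letter (detach φ d) d := by
  obtain ⟨t, ht⟩ := exists_isCycleList_cons φ d
  have hmem : reverseEdge E d ∈ t := by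
    have := ht.mem_iff.2 hs
    rcases List.mem_cons.1 this with h | h
    · exact absurd h (reverseEdge_ne d)
    · exact h
  obtain ⟨u, v, rfl⟩ := List.append_of_mem hmem
  cases u with
  | nil => exact absurd ht.walk.2.1 hd
  | cons z u =>
    rw [← List.cons_append] at ht
    obtain ⟨h1, h2⟩ := ht.detach_split
    have hle : compSetoid (detach φ d) ≤ compSetoid φ := by
      conv_rhs => rw [← glue_compSetoid_detach φ d]
      exact Setoid.le_glue _ _ _
    have hn := (hp.detach_of_sameCycle hd hs).2
    have hr := compSetoid_reverseEdge (detach φ d) d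
    have hn' : ¬ compSetoid (detach φ d) (φ d) d := fun h => hn ((compSetoid _).trans h hr)
    have hother : ∀ x, compSetoid φ d x → x ∉ z :: u → x ∉ d :: reverseEdge E d :: v →
        cycleLabel letter (detach φ d) x ∈ P.symRelators := by
      intro x hx hx1 hx2
      have hns : ¬ SameCycle φ d x := by
        rw [← ht.mem_iff]
        simp only [List.mem_cons, List.mem_append, not_or] at hx1 hx2 ⊢
        exact ⟨⟨hx2.1, hx1.1, hx1.2⟩, hx2.2⟩
      rw [cycleLabel_detach hns fun e => hns (hs.trans e)]
      exact (hdisc x hx).resolve_left hns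
    refine ⟨z :: u, v, ht, h1, h2, fun x hx => ?_, fun x hx => ?_⟩
    · by_cases hx1 : x ∈ z :: u
      · exact Or.inl (h1.mem_iff.1 hx1)
      · refine Or.inr (hother x ((compSetoid _).trans (compSetoid_apply_right φ d) (hle hx)) hx1
          fun hx2 => hn' ?_)
        exact (compSetoid _).trans hx
          ((compSetoid _).symm (cycleSetoid_le_compSetoid _ (h2.mem_iff.1 hx2)))
    · by_cases hx2 : x ∈ d :: reverseEdge E d :: v
      · exact Or.inl (h2.mem_iff.1 hx2)
      · refine Or.inr (hother x (hle hx) (fun hx1 => hn' ?_) hx2)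
        exact (compSetoid _).trans (cycleSetoid_le_compSetoid _ (h1.mem_iff.1 hx1))
          ((compSetoid _).symm hx)

omit [DecidableEq E] [Finite E] in
theorem component_eq_pair (h1 : φ d = reverseEdge E d) (h2 : φ (reverseEdge E d) = d) :
    component φ d = {d, reverseEdge E d} := by
  classical
  ext x
  constructor
  · intro hx
    have hle : compSetoid φ ≤ Setoid.ker (fun y => y = d ∨ y = reverseEdge E d) := by
      refine compSetoid_le_iff.2 ⟨fun y => ?_, fun y => ?_⟩
      · rw [Setoid.ker_def, eq_iff_iff]
        constructor
        · rintro (rfl | rfl)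
          · exact Or.inr h1
          · exact Or.inl h2
        · rintro (h | h)
          · exact Or.inr (φ.injective (h.trans h2.symm))
          · exact Or.inl (φ.injective (h.trans h1.symm))
      · rw [Setoid.ker_def, eq_iff_iff]
        constructor
        · rintro (rfl | rfl)
          · exact Or.inr rfl
          · exact Or.inl (reverseEdge_reverseEdge d)
        · rintro (h | h)
          · exact Or.inr (by rw [← h, reverseEdge_reverseEdge])
          · exact Or.inl ((reverseEdge E).injective h)
    have := hle hx
    rw [Setoid.ker_def, eq_iff_iff] at this
    exact this.1 (Or.inl rfl)
  · rintro (rfl | rfl)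
    · exact (compSetoid φ).refl _
    · exact compSetoid_reverseEdge φ d

omit [DecidableEq E] in
theorem vertexCount_eq_two (h1 : φ d = reverseEdge E d) (h2 : φ (reverseEdge E d) = d) :
    vertexCount φ d = 2 := by
  rw [vertexCount, component_eq_pair h1 h2]
  refine classCountOn_pair fun h => ?_
  have h3 : vertexPerm φ d = d := h2
  exact reverseEdge_ne d (SameCycle.eq_of_left h h3).symm

omit [DecidableEq E] [Finite E] in
theorem component_eq_of_rel {x : E × Bool} (h : compSetoid φ d x) :
    component φ d = component φ x :=
  Set.ext fun _ => ⟨fun h' => (compSetoid φ).trans ((compSetoid φ).symm h) h',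
    fun h' => (compSetoid φ).trans h h'⟩

omit [DecidableEq E] [Finite E] in
theorem vertexCount_eq_of_rel {x : E × Bool} (h : compSetoid φ d x) :
    vertexCount φ d = vertexCount φ x := by
  rw [vertexCount, vertexCount, component_eq_of_rel h]

/-- Deleting an edge that ends in a vertex of degree one. -/
theorem decomposes_of_leaf {t : List (E × Bool)} (hp : IsPlanarMap φ)
    (hl : IsCycleList φ d (d :: reverseEdge E d :: t)) (hdisc : IsDiscComponent P letter φ d)
    (ih : ∀ ψ : Perm (E × Bool), cycleCount (vertexPerm φ) < cycleCount (vertexPerm ψ) →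
      IsPlanarMap ψ → ∀ c, IsDiscComponent P letter ψ c →
      ∃ f, P.Decomposes (cycleLabel letter ψ c) (vertexCount ψ c) f) :
    ∃ v f, P.Decomposes (t.map (dartLabel letter)) v f ∧ v + 1 = vertexCount φ d := by
  have h1 : φ d = reverseEdge E d := hl.walk.2.1
  -- Either the leaf is an isolated segment, and one vertex is left over, or it is cut off at its
  -- other end as well. It then stays in the map as a separate component with two vertices, so that
  -- the edge type never changes.
  by_cases h2 : φ (reverseEdge E d) = d
  · have ht : t = [] := by
      cases t with
      | nil => rfl
      | cons z t =>
        have h3 : φ (reverseEdge E d) = z := h1 ▸ hl.walk.2.2.1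
        have := hl.nodup
        rw [List.nodup_cons] at this
        exact (this.1 (by rw [← h3, h2]; simp)).elim
    subst ht
    exact ⟨1, 0, .nil, by rw [vertexCount_eq_two h1 h2]⟩
  · have hrr := reverseEdge_reverseEdge d
    generalize hd' : reverseEdge E d = d' at *
    have hd'' : reverseEdge E d' = d := hrr
    have h2' : φ d' ≠ reverseEdge E d' := by rwa [hd'']
    have hs : SameCycle φ d d' := by rw [← h1]; exact (SameCycle.refl _ _).apply_right
    have hs' : SameCycle φ d' (reverseEdge E d') := by rw [hd'']; exact hs.symm
    have hc : compSetoid φ d d' := cycleSetoid_le_compSetoid _ hs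
    have hdisc' : IsDiscComponent P letter φ d' := fun x hx =>
      (hdisc x ((compSetoid φ).trans hc hx)).imp (fun h => hs.symm.trans h) id
    obtain ⟨u, v, hl1, hl2, hl3, hl4, hl5⟩ := exists_detach_split hp h2' hs' hdisc'
    rw [hd''] at hl1 hl3
    have hcount := cycleCount_vertexPerm_detach h2'
    obtain ⟨f, hf⟩ := ih (detach φ d') (by omega) (hp.detach_of_sameCycle h2' hs').1 _ hl4
    have hv := vertexCount_detach_of_sameCycle hp h2' hs'
    -- The same cycle is read in two ways from `d'`; since `d` occurs only once, its positions
    -- agree.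
    have htu : t = u ∧ v = [] := by
      have hrot : IsCycleList φ d' (d' :: (t ++ [d])) := by
        refine ⟨⟨rfl, ?_⟩, ?_, by simp⟩
        · rw [← h1]
          exact hl.walk.2.2.append ⟨rfl, rfl⟩
        · have := hl.nodup
          rw [← List.cons_append]
          exact (List.nodup_middle (l₁ := d' :: t) (l₂ := [])).2 (by simpa using this)
      have heq := hrot.eq_iterate.trans hl1.eq_iterate.symm
      simp only [List.cons_append, List.cons.injEq, true_and] at heq
      have hnd := hrot.nodup
      have hdt : d ∉ t := by
        have := hl.nodup
        simp only [List.nodup_cons, List.mem_cons, not_or] at this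
        exact this.1.2
      have hdu : d ∉ u := fun h => by
        have := hl1.nodup
        rw [List.nodup_append] at this
        exact this.2.2 d (by simp [h]) d (by simp) rfl
      rcases List.append_eq_append_iff.1 heq with ⟨a, ha, ha'⟩ | ⟨a, ha, ha'⟩
      · cases a with
        | nil => simp_all
        | cons b a =>
          simp only [List.cons_append, List.cons.injEq] at ha'
          rw [← ha'.1] at ha
          exact absurd (by rw [ha]; simp) hdu
      · cases a with
        | nil => simp_all
        | cons b a =>
          simp only [List.cons_append, List.cons.injEq] at ha'
          rw [← ha'.1] at ha
          exact absurd (by rw [ha]; simp) hdt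
    obtain ⟨rfl, rfl⟩ := htu
    rw [hl2.cycleLabel_eq] at hf
    have hv2 : vertexCount (detach φ d') d' = 2 := by
      refine vertexCount_eq_two (detach_apply_self φ d') ?_
      rw [hd'']
      have := hl3.walk.2.2
      rwa [detach_apply_self, hd''] at this
    refine ⟨_, f, hf, ?_⟩
    rw [vertexCount_eq_of_rel hc]
    omega

/-- A planar map all of whose faces but one are labelled by relators can be decomposed. -/
theorem exists_decomposes (hp : IsPlanarMap φ) (hdisc : IsDiscComponent P letter φ d) :
    ∃ f, P.Decomposes (cycleLabel letter φ d) (vertexCount φ d) f := by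
  -- Edges are cut off and never deleted, so the number of vertices grows; it is bounded by the
  -- number of oriented edges.
  induction hn : Nat.card (E × Bool) - cycleCount (vertexPerm φ) using Nat.strong_induction_on
    generalizing φ d with
  | _ n ih =>
    replace ih : ∀ ψ : Perm (E × Bool), cycleCount (vertexPerm φ) < cycleCount (vertexPerm ψ) →
        IsPlanarMap ψ → ∀ c, IsDiscComponent P letter ψ c →
        ∃ f, P.Decomposes (cycleLabel letter ψ c) (vertexCount ψ c) f := by
      intro ψ hlt hψ c hc
      have h2 : cycleCount (vertexPerm ψ) ≤ _ := classCount_le_card _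
      exact ih _ (by omega) hψ hc rfl
    by_cases hd : φ d = reverseEdge E d
    · obtain ⟨t, ht⟩ : ∃ t, IsCycleList φ d (d :: reverseEdge E d :: t) := by
        obtain ⟨t, ht⟩ := exists_isCycleList_cons φ d
        cases t with
        | nil =>
          have h1 : φ d = d := ht.walk.2
          exact absurd (hd.symm.trans h1) (reverseEdge_ne d)
        | cons z t =>
          have h1 : φ d = z := ht.walk.2.1
          exact ⟨t, by rwa [← hd, h1]⟩
      obtain ⟨v, f, hf, hv⟩ := decomposes_of_leaf hp ht hdisc ih
      refine ⟨0 + f, ?_⟩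
      rw [ht.cycleLabel_eq, ← hv, add_comm v 1]
      exact .bridge _ _ .nil hf
    have hcount := cycleCount_vertexPerm_detach hd
    replace ih : ∀ ψ : Perm (E × Bool),
        cycleCount (vertexPerm (detach φ d)) ≤ cycleCount (vertexPerm ψ) →
        IsPlanarMap ψ → ∀ c, IsDiscComponent P letter ψ c →
        ∃ f, P.Decomposes (cycleLabel letter ψ c) (vertexCount ψ c) f :=
      fun ψ hlt => ih ψ (by omega)
    by_cases hs : SameCycle φ d (reverseEdge E d)
    -- A bridge: the loop at its far end becomes one component, and in the other `d` is a leaf.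
    · obtain ⟨u, v, h1, h2, h3, h4, h5⟩ := exists_detach_split hp hd hs hdisc
      have hp' := (hp.detach_of_sameCycle hd hs).1
      obtain ⟨n, f, hf, hn⟩ := decomposes_of_leaf hp' h3 h5 fun ψ hψ => ih ψ hψ.le
      obtain ⟨g, hg⟩ := ih _ le_rfl hp' _ h4
      have hv := vertexCount_detach_of_sameCycle hp hd hs
      rw [h2.cycleLabel_eq] at hg
      refine ⟨g + f, ?_⟩
      have : vertexCount φ d = vertexCount (detach φ d) (φ d) + n := by omega
      rw [h1.cycleLabel_eq, this, List.map_append]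
      exact .bridge _ _ hg hf
    -- A relator face lies across `d`. Detaching merges it with the outer face; the vertex gained is
    -- lost again when the leaf `d` is removed.
    · obtain ⟨y, hy⟩ := exists_isCycleList_cons φ d
      obtain ⟨x, hx⟩ := exists_isCycleList_cons φ (reverseEdge E d)
      have hm := hy.detach_merge hx hs
      have hcomp := compSetoid_detach_of_not hs
      have hdisc' : IsDiscComponent P letter (detach φ d) d := by
        intro c hc
        rw [hcomp] at hc
        by_cases h1 : SameCycle φ d c
        · refine Or.inl (hm.mem_iff.1 ?_)
          have := hy.mem_iff.2 h1
          simp only [List.mem_cons, List.mem_append] at this ⊢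
          tauto
        by_cases h2 : SameCycle φ (reverseEdge E d) c
        · refine Or.inl (hm.mem_iff.1 ?_)
          have := hx.mem_iff.2 h2
          simp only [List.mem_cons, List.mem_append] at this ⊢
          tauto
        rw [cycleLabel_detach h1 h2]
        exact Or.inr ((hdisc c hc).resolve_left h1)
      have hp' := hp.detach_of_not hd hs
      obtain ⟨v, f, hf, hv⟩ := decomposes_of_leaf hp' hm hdisc' fun ψ hψ => ih ψ hψ.le
      rw [vertexCount_detach_of_not hd hs, Nat.add_right_cancel_iff] at hv
      refine ⟨f + 1, ?_⟩
      rw [hy.cycleLabel_eq, ← hv]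
      rw [List.map_append] at hf
      refine .face _ _ hf ?_
      have := (hdisc _ (compSetoid_reverseEdge φ d)).resolve_left hs
      rwa [hx.cycleLabel_eq] at this

end Decompose

/-! ### Diagrams as planar maps, and the counts inside one diagram -/

namespace VanKampenDiagram

variable {α : Type*} {P : GroupPresentation α} (Δ : VanKampenDiagram P)

theorem card_vertex_pos : 0 < Nat.card Δ.Vertex := by
  have := Δ.finite_vertex
  have := Δ.nonempty_vertex
  exact Nat.card_pos

theorem compSetoid_next (x y : Δ.Edge × Bool) : compSetoid Δ.next x y := by
  have hv : ∀ {a b}, Δ.origin a = Δ.origin b → compSetoid Δ.next a b := fun h =>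
    cycleSetoid_vertexPerm_le_compSetoid _ ((Δ.origin_eq_iff _ _).1 h)
  have key : ∀ v, Relation.ReflTransGen
      (fun u u' => ∃ d, Δ.origin d = u ∧ Δ.origin (reverseEdge Δ.Edge d) = u') (Δ.origin x) v →
      ∀ y, Δ.origin y = v → compSetoid Δ.next x y := by
    intro v h
    induction h with
    | refl => intro y hy; exact hv hy.symm
    | tail _ hstep ih =>
      obtain ⟨d, hd, hd'⟩ := hstep
      intro y hy
      exact (compSetoid _).trans (ih d hd) ((compSetoid _).trans
        (compSetoid_reverseEdge Δ.next d) (hv (hd'.trans hy.symm)))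
  exact key _ (Δ.connected _ _) y rfl

theorem exists_origin_eq [Nonempty Δ.Edge] (v : Δ.Vertex) : ∃ d, Δ.origin d = v := by
  let d₀ : Δ.Edge × Bool := (Classical.arbitrary _, true)
  rcases Relation.ReflTransGen.cases_head (Δ.connected v (Δ.origin d₀)) with h | ⟨_, ⟨d, hd, -⟩, -⟩
  · exact ⟨d₀, h.symm⟩
  · exact ⟨d, hd⟩

theorem cycleCount_vertexPerm_next [Nonempty Δ.Edge] :
    cycleCount (vertexPerm Δ.next) = Nat.card Δ.Vertex := by
  refine Nat.card_eq_of_bijective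
    (Quotient.lift Δ.origin fun a b h => (Δ.origin_eq_iff a b).2 h) ⟨?_, ?_⟩
  · intro p q h
    induction p using Quotient.inductionOn with | _ x => ?_
    induction q using Quotient.inductionOn with | _ y => ?_
    exact Quotient.sound ((Δ.origin_eq_iff x y).1 h)
  · intro v
    obtain ⟨d, hd⟩ := Δ.exists_origin_eq v
    exact ⟨Quotient.mk _ d, hd⟩

theorem cycleCount_next [h : Nonempty Δ.Edge] :
    cycleCount Δ.next = Nat.card Δ.Face + 1 := by
  have := Δ.finite_face
  rw [← Finite.card_option]
  refine Nat.card_eq_of_bijective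
    (Quotient.lift Δ.leftFace fun a b h => (Δ.leftFace_eq_iff a b).2 h) ⟨?_, ?_⟩
  · intro p q h
    induction p using Quotient.inductionOn with | _ x => ?_
    induction q using Quotient.inductionOn with | _ y => ?_
    exact Quotient.sound ((Δ.leftFace_eq_iff x y).1 h)
  · rintro (_ | f)
    · obtain ⟨d, hd⟩ := Δ.exists_leftFace_eq_none h
      exact ⟨Quotient.mk _ d, hd⟩
    · obtain ⟨d, hd⟩ := Δ.exists_leftFace_eq_some f
      exact ⟨Quotient.mk _ d, hd⟩

theorem isPlanarMap_next [h : Nonempty Δ.Edge] : IsPlanarMap Δ.next := by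
  have h1 : classCount (compSetoid Δ.next) = 1 := by
    have : Subsingleton (Quotient (compSetoid Δ.next)) := ⟨fun p q => by
      induction p using Quotient.inductionOn with | _ x => ?_
      induction q using Quotient.inductionOn with | _ y => ?_
      exact Quotient.sound (Δ.compSetoid_next x y)⟩
    have : Nonempty (Quotient (compSetoid Δ.next)) :=
      ⟨Quotient.mk _ (Classical.arbitrary _, true)⟩
    exact Nat.card_unique
  have := Δ.euler
  rw [IsPlanarMap, Δ.cycleCount_next, Δ.cycleCount_vertexPerm_next, h1]
  omega

theorem exists_decomposes {w : List (α × Bool)} (hw : Δ.IsBoundaryLabel w) :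
    ∃ f, P.Decomposes w (Δ.numCells 0) f := by
  classical
  have := Δ.finite_edge
  rcases hw with ⟨d, hd, rfl⟩ | ⟨hE, rfl⟩
  · have : Nonempty Δ.Edge := ⟨d.1⟩
    have hdisc : IsDiscComponent P Δ.letter Δ.next d := fun x _ => by
      by_cases hx : Δ.leftFace x = none
      · exact Or.inl ((Δ.leftFace_eq_iff d x).1 (hd.trans hx.symm))
      · exact Or.inr (Δ.relator x hx)
    obtain ⟨f, hf⟩ := _root_.exists_decomposes Δ.isPlanarMap_next hdisc
    refine ⟨f, ?_⟩
    have hc : component Δ.next d = Set.univ := Set.eq_univ_of_forall fun x => Δ.compSetoid_next d x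
    rw [vertexCount, hc, classCountOn_univ] at hf
    rw [numCells, ← Δ.cycleCount_vertexPerm_next]
    exact hf
  · have h1 := Δ.euler
    have h2 := Δ.card_vertex_pos
    rw [Nat.card_of_isEmpty (α := Δ.Edge)] at h1
    have h3 : Nat.card Δ.Vertex = 1 := by omega
    rw [numCells, h3]
    exact ⟨0, .nil⟩

theorem numCells_zero_le : Δ.numCells 0 ≤ Δ.numCells 1 + 1 := by
  have := Δ.euler
  simp only [numCells]
  omega

theorem length_faceLabel (d : Δ.Edge × Bool) :
    (Δ.faceLabel d).length = Nat.card {x // Δ.leftFace x = Δ.leftFace d} := by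
  classical
  have := Δ.finite_edge
  have hc := isCycleList_iterate Δ.next d
  rw [faceLabel, cycleLabel, List.length_map, ← List.toFinset_card_of_nodup hc.nodup]
  refine (Nat.subtype_card _ fun x => ?_).symm
  rw [List.mem_toFinset, hc.mem_iff, Δ.leftFace_eq_iff]
  exact sameCycle_comm

/-- Summing boundary lengths over all faces, the outer one included, counts each edge twice. -/
theorem numCells_one_le {M : ℕ} (hM : ∀ R ∈ P.relators, R.length ≤ M) {w : List (α × Bool)}
    (hw : Δ.IsBoundaryLabel w) : Δ.numCells 1 ≤ M * Δ.numCells 2 + w.length := by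
  classical
  have := Δ.finite_edge
  have := Δ.finite_face
  have := Fintype.ofFinite Δ.Face
  rcases hw with ⟨d, hd, rfl⟩ | ⟨hE, rfl⟩
  · have h1 : Nat.card (Δ.Edge × Bool) = ∑ f : Option Δ.Face, Nat.card {x // Δ.leftFace x = f} := by
      rw [← Nat.card_congr (Equiv.sigmaFiberEquiv Δ.leftFace), Nat.card_sigma]
    rw [Fintype.sum_option, Nat.card_prod, ← hd, ← length_faceLabel] at h1
    have h2 : ∀ f : Δ.Face, Nat.card {x // Δ.leftFace x = some f} ≤ M := by
      intro f
      obtain ⟨x, hx⟩ := Δ.exists_leftFace_eq_some f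
      rw [← hx, ← length_faceLabel]
      obtain ⟨R, hR, h | h⟩ := Δ.relator x (by rw [hx]; simp)
      · exact h.perm.length_eq.trans_le (hM R hR)
      · rw [faceLabel, h.perm.length_eq, FreeGroup.invRev_length]
        exact hM R hR
    have h3 := Finset.sum_le_card_nsmul Finset.univ _ M fun f _ => h2 f
    rw [Finset.card_univ, ← Nat.card_eq_fintype_card, smul_eq_mul] at h3
    have h4 : Nat.card Bool = 2 := by simp
    rw [h4] at h1
    simp only [numCells]
    rw [mul_comm M]
    omega
  · simp [numCells, Nat.card_of_isEmpty]

end VanKampenDiagram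

/-! ### Area of elements of the normal closure -/

namespace GroupPresentation

open FreeGroup (invRev invRev_length inv_mk mul_mk)

variable {α : Type*} (P : GroupPresentation α)

/-- The normal closure of the relators. -/
abbrev kernel : Subgroup (FreeGroup α) := Subgroup.normalClosure (FreeGroup.mk '' P.relators)

/-- `g` is a product of at most `k` conjugates of relators and their inverses. -/
inductive AreaLE : ℕ → FreeGroup α → Prop
  | one (k : ℕ) : AreaLE k 1
  | cons {k : ℕ} {r : List (α × Bool)} {h : FreeGroup α} (g : FreeGroup α)
      (hr : r ∈ P.symRelators) (hh : AreaLE k h) : AreaLE (k + 1) (g * FreeGroup.mk r * g⁻¹ * h)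

variable {P}

theorem mk_isRotated_conj {w w' : List (α × Bool)} (h : w.IsRotated w') :
    ∃ g : FreeGroup α, FreeGroup.mk w' = g * FreeGroup.mk w * g⁻¹ := by
  obtain ⟨n, hn, rfl⟩ := List.isRotated_iff_mod.1 h
  refine ⟨(FreeGroup.mk (w.take n))⁻¹, ?_⟩
  have h1 : FreeGroup.mk w = FreeGroup.mk (w.take n) * FreeGroup.mk (w.drop n) := by
    rw [mul_mk, List.take_append_drop]
  rw [List.rotate_eq_drop_append_take hn, ← mul_mk, h1]
  group

theorem isRotated_invRev {w w' : List (α × Bool)} (h : w.IsRotated w') :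
    (invRev w).IsRotated (invRev w') := (h.map _).reverse

theorem invRev_mem_symRelators {r : List (α × Bool)} (hr : r ∈ P.symRelators) :
    invRev r ∈ P.symRelators := by
  obtain ⟨R, hR, h | h⟩ := hr
  · exact ⟨R, hR, Or.inr (isRotated_invRev h)⟩
  · exact ⟨R, hR, Or.inl (by simpa using isRotated_invRev h)⟩

theorem mk_mem_kernel_of_mem_symRelators {r : List (α × Bool)} (hr : r ∈ P.symRelators) :
    FreeGroup.mk r ∈ P.kernel := by
  obtain ⟨R, hR, h | h⟩ := hr
  · obtain ⟨g, hg⟩ := mk_isRotated_conj h.symm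
    rw [hg]
    exact Subgroup.normalClosure_normal.conj_mem _
      (Subgroup.subset_normalClosure (Set.mem_image_of_mem _ hR)) g
  · obtain ⟨g, hg⟩ := mk_isRotated_conj h.symm
    rw [hg, ← inv_mk]
    exact Subgroup.normalClosure_normal.conj_mem _ (inv_mem
      (Subgroup.subset_normalClosure (Set.mem_image_of_mem _ hR))) g

namespace AreaLE

theorem mono {k l : ℕ} {g : FreeGroup α} (h : P.AreaLE k g) (hkl : k ≤ l) : P.AreaLE l g := by
  induction h generalizing l with
  | one k => exact .one l
  | cons g hr _ ih =>
    obtain ⟨m, rfl⟩ : ∃ m, l = m + 1 := ⟨l - 1, by omega⟩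
    exact .cons g hr (ih (by omega))

theorem mul {k l : ℕ} {g h : FreeGroup α} (hg : P.AreaLE k g) (hh : P.AreaLE l h) :
    P.AreaLE (k + l) (g * h) := by
  induction hg with
  | one k => rw [one_mul]; exact hh.mono (by omega)
  | cons g hr _ ih =>
    rw [mul_assoc, Nat.add_right_comm]
    exact .cons g hr ih

theorem of_mem_symRelators {r : List (α × Bool)} (hr : r ∈ P.symRelators) (g : FreeGroup α) :
    P.AreaLE 1 (g * FreeGroup.mk r * g⁻¹) := by
  have := AreaLE.cons (P := P) g hr (.one 0)
  rwa [mul_one] at this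

theorem conj {k : ℕ} {g : FreeGroup α} (hg : P.AreaLE k g) (x : FreeGroup α) :
    P.AreaLE k (x * g * x⁻¹) := by
  induction hg with
  | one k => rw [mul_one, mul_inv_cancel]; exact .one k
  | @cons k r h g hr _ ih =>
    have := AreaLE.cons (P := P) (x * g) hr ih
    convert this using 1
    group

theorem inv {k : ℕ} {g : FreeGroup α} (hg : P.AreaLE k g) : P.AreaLE k g⁻¹ := by
  induction hg with
  | one k => rw [inv_one]; exact .one k
  | @cons k r h g hr _ ih =>
    have := ih.mul (of_mem_symRelators (invRev_mem_symRelators hr) g)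
    convert this using 1
    rw [← inv_mk]
    group

/-- The elements of finite area form a normal subgroup that contains the relators. -/
theorem exists_of_mem_kernel {g : FreeGroup α} (hg : g ∈ P.kernel) : ∃ k, P.AreaLE k g := by
  let N : Subgroup (FreeGroup α) :=
    { carrier := {g | ∃ k, P.AreaLE k g}
      one_mem' := ⟨0, .one 0⟩
      mul_mem' := fun ⟨k, hk⟩ ⟨l, hl⟩ => ⟨k + l, hk.mul hl⟩
      inv_mem' := fun ⟨k, hk⟩ => ⟨k, hk.inv⟩ }
  have hN : N.Normal := ⟨fun g ⟨k, hk⟩ x => ⟨k, hk.conj x⟩⟩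
  have hle : P.kernel ≤ N := by
    refine Subgroup.normalClosure_le_normal ?_
    rintro _ ⟨R, hR, rfl⟩
    refine ⟨1, ?_⟩
    have := of_mem_symRelators (P := P) ⟨R, hR, Or.inl (List.IsRotated.refl R)⟩ 1
    simpa using this
  exact hle hg

end AreaLE

/-- Over a finite alphabet there are only finitely many words of bounded length. This is the source
of the constant `c`. -/
theorem exists_areaLE_of_length_le [Finite α] (P : GroupPresentation α) (n : ℕ) :
    ∃ c, ∀ w : List (α × Bool), w.length ≤ n → FreeGroup.mk w ∈ P.kernel → P.AreaLE c (FreeGroup.mk w) := by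
  have hfin : {w : List (α × Bool) | w.length ≤ n}.Finite := List.finite_length_le _ n
  choose! k hk using fun (w : List (α × Bool)) (hw : FreeGroup.mk w ∈ P.kernel) =>
    AreaLE.exists_of_mem_kernel hw
  obtain ⟨c, hc⟩ := (hfin.image k).bddAbove
  exact ⟨c, fun w hw hw' => (hk w hw').mono (hc (Set.mem_image_of_mem k hw))⟩

/-! ### Bounding the area by the number of vertices -/

section Collapse

variable (P)

/-- The element of the group presented by `P` that a word represents. -/
def wordVal (w : List (α × Bool)) : FreeGroup α ⧸ P.kernel := QuotientGroup.mk (FreeGroup.mk w)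

variable {P}

theorem wordVal_append (u w : List (α × Bool)) :
    P.wordVal (u ++ w) = P.wordVal u * P.wordVal w := by
  rw [wordVal, ← mul_mk]; rfl

theorem wordVal_cons (a : α × Bool) (w : List (α × Bool)) :
    P.wordVal (a :: w) = P.wordVal [a] * P.wordVal w := wordVal_append [a] w

theorem wordVal_invRev (w : List (α × Bool)) : P.wordVal (invRev w) = (P.wordVal w)⁻¹ := by
  rw [wordVal, ← inv_mk]; rfl

theorem wordVal_flip (a : α) (b : Bool) : P.wordVal [(a, !b)] = (P.wordVal [(a, b)])⁻¹ :=
  wordVal_invRev [(a, b)]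

theorem wordVal_eq_one_iff {w : List (α × Bool)} : P.wordVal w = 1 ↔ FreeGroup.mk w ∈ P.kernel :=
  QuotientGroup.eq_one_iff _

open Classical in
variable (P) in
/-- Delete from a word the letters that are trivial in the group. -/
noncomputable def keepNontrivial (w : List (α × Bool)) : List (α × Bool) :=
  w.filter fun a => P.wordVal [a] ≠ 1

theorem keepNontrivial_append (u w : List (α × Bool)) :
    P.keepNontrivial (u ++ w) = P.keepNontrivial u ++ P.keepNontrivial w := List.filter_append ..

theorem keepNontrivial_cons_of_eq {a : α × Bool} (h : P.wordVal [a] = 1) (w : List (α × Bool)) :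
    P.keepNontrivial (a :: w) = P.keepNontrivial w := by
  simp [keepNontrivial, h]

theorem keepNontrivial_cons_of_ne {a : α × Bool} (h : P.wordVal [a] ≠ 1) (w : List (α × Bool)) :
    P.keepNontrivial (a :: w) = a :: P.keepNontrivial w := by
  simp [keepNontrivial, h]

theorem wordVal_keepNontrivial (w : List (α × Bool)) :
    P.wordVal (P.keepNontrivial w) = P.wordVal w := by
  induction w with
  | nil => rfl
  | cons a w ih =>
    by_cases h : P.wordVal [a] = 1
    · rw [keepNontrivial_cons_of_eq h, ih, wordVal_cons a, h, one_mul]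
    · rw [keepNontrivial_cons_of_ne h, wordVal_cons, ih, ← wordVal_cons]

variable (P) in
/-- The words agree letter by letter in the group. -/
def LetterwiseEq : List (α × Bool) → List (α × Bool) → Prop :=
  List.Forall₂ fun a b => P.wordVal [a] = P.wordVal [b]

theorem LetterwiseEq.wordVal_eq {u w : List (α × Bool)} (h : P.LetterwiseEq u w) :
    P.wordVal u = P.wordVal w := by
  induction h with
  | nil => rfl
  | cons h _ ih => rw [wordVal_cons, h, ih, ← wordVal_cons]

theorem LetterwiseEq.append {u u' w w' : List (α × Bool)} (h : P.LetterwiseEq u u')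
    (h' : P.LetterwiseEq w w') : P.LetterwiseEq (u ++ w) (u' ++ w') :=
  List.rel_append h h'

theorem LetterwiseEq.exists_append {u v w : List (α × Bool)} (h : P.LetterwiseEq (u ++ v) w) :
    ∃ u' v', w = u' ++ v' ∧ P.LetterwiseEq u u' ∧ P.LetterwiseEq v v' := by
  refine ⟨w.take u.length, w.drop u.length, (List.take_append_drop _ _).symm, ?_, ?_⟩
  · have := List.forall₂_take u.length h
    rwa [List.take_left] at this
  · have := List.forall₂_drop u.length h
    rwa [List.drop_left] at this

/-- Deleting a trivial letter, or exchanging a letter for an equal one, inserts one trivial word of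
length at most two and so costs at most `c`. -/
theorem AreaLE.of_letterwiseEq {c : ℕ}
    (hc : ∀ w : List (α × Bool), w.length ≤ 2 → FreeGroup.mk w ∈ P.kernel → P.AreaLE c (FreeGroup.mk w))
    {w w' : List (α × Bool)} (h : P.LetterwiseEq (P.keepNontrivial w) w') :
    P.AreaLE (c * w.length) (FreeGroup.mk w * (FreeGroup.mk w')⁻¹) := by
  induction w generalizing w' with
  | nil => cases h; rw [mul_inv_cancel]; exact .one _
  | cons a w ih =>
    rw [List.length_cons, Nat.mul_succ, add_comm]
    by_cases ha : P.wordVal [a] = 1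
    · rw [keepNontrivial_cons_of_eq ha] at h
      have := (hc [a] (by simp) (wordVal_eq_one_iff.1 ha)).mul (ih h)
      rwa [← mul_assoc, mul_mk] at this
    · rw [keepNontrivial_cons_of_ne ha] at h
      cases h with
      | @cons _ b _ w' hab h =>
        have h1 := hc ([a] ++ invRev [b]) (by simp) (wordVal_eq_one_iff.1 (by
          rw [wordVal_append, wordVal_invRev, hab, mul_inv_cancel]))
        have h2 := h1.mul ((ih h).conj (FreeGroup.mk [b]))
        convert h2 using 1
        rw [← mul_mk, ← inv_mk]
        change FreeGroup.mk ([a] ++ w) * (FreeGroup.mk ([b] ++ w'))⁻¹ = _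
        rw [← mul_mk, ← mul_mk]
        group

/-- The area of the boundary label of a diagram is bounded by the number of its vertices, up to
replacing letters by equal letters and deleting trivial letters. -/
theorem Decomposes.exists_letterwiseEq {M c : ℕ} (hM : ∀ r ∈ P.symRelators, r.length ≤ M)
    (hc : ∀ w : List (α × Bool), w.length ≤ M + 2 → FreeGroup.mk w ∈ P.kernel → P.AreaLE c (FreeGroup.mk w))
    {w : List (α × Bool)} {v f : ℕ} (h : P.Decomposes w v f) :
    ∃ w' k, P.LetterwiseEq (P.keepNontrivial w) w' ∧ P.AreaLE k (FreeGroup.mk w') ∧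
      k + c * w'.length + 2 * c ≤ 2 * c * v := by
  -- The left side of the estimate is a potential. At a bridge two terms `2c` become one, which pays
  -- for the two new letters. At a face `v` is unchanged, so area `c` may be spent only if the word
  -- becomes shorter.
  induction h with
  | nil => exact ⟨[], 0, List.Forall₂.nil, .one 0, by simp⟩
  | @bridge u w v₁ v₂ f₁ f₂ a b _ _ ihu ihw =>
    obtain ⟨u', k, hu1, hu2, hu3⟩ := ihu
    obtain ⟨w', l, hw1, hw2, hw3⟩ := ihw
    by_cases ha : P.wordVal [(a, b)] = 1
    · refine ⟨u' ++ w', k + l, ?_, ?_, ?_⟩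
      · rw [keepNontrivial_cons_of_eq ha, keepNontrivial_append, keepNontrivial_cons_of_eq]
        · exact hu1.append hw1
        · rw [wordVal_flip, ha, inv_one]
      · rw [← mul_mk]; exact hu2.mul hw2
      · rw [List.length_append]; nlinarith
    · refine ⟨(a, b) :: (u' ++ (a, !b) :: w'), k + l, ?_, ?_, ?_⟩
      · rw [keepNontrivial_cons_of_ne ha, keepNontrivial_append, keepNontrivial_cons_of_ne]
        · exact List.Forall₂.cons rfl (hu1.append (List.Forall₂.cons rfl hw1))
        · rwa [wordVal_flip, Ne, inv_eq_one]
      · have h1 := (hu2.conj (FreeGroup.mk [(a, b)])).mul hw2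
        convert h1 using 1
        rw [inv_mk, mul_mk, mul_mk, mul_mk]
        simp [invRev]
      · simp only [List.length_append, List.length_cons]; nlinarith
  | @face x y v f a b _ hx ih =>
    obtain ⟨z, k, hz1, hz2, hz3⟩ := ih
    rw [keepNontrivial_append] at hz1
    obtain ⟨x', y', rfl, hx', hy'⟩ := hz1.exists_append
    rw [← mul_mk] at hz2
    have hval : P.wordVal x' = P.wordVal [(a, b)] := by
      have h1 := wordVal_eq_one_iff.2 (mk_mem_kernel_of_mem_symRelators hx)
      rw [wordVal_cons, wordVal_flip, inv_mul_eq_one] at h1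
      rw [← hx'.wordVal_eq, wordVal_keepNontrivial, h1]
    have hxlen : x'.length ≤ M := by
      have h1 := hM _ hx
      have h2 : (P.keepNontrivial x).length ≤ x.length := List.length_filter_le _ _
      rw [← List.Forall₂.length_eq hx']
      rw [List.length_cons] at h1
      omega
    -- The peeled edge is deleted, so `x'` is trivial and must disappear: for free if it is empty,
    -- otherwise at cost `c` with at least one letter lost.
    by_cases ha : P.wordVal [(a, b)] = 1
    · rw [keepNontrivial_cons_of_eq ha]
      cases hxe : x' with
      | nil =>
        subst hxe
        refine ⟨y', k, hy', by simpa using hz2, by simpa using hz3⟩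
      | cons e x'' =>
        refine ⟨y', c + k, hy', ?_, ?_⟩
        · have h1 := (hc x' (by omega) (wordVal_eq_one_iff.1 (hval.trans ha))).inv.mul hz2
          rwa [inv_mul_cancel_left] at h1
        · rw [hxe, List.cons_append, List.length_cons, List.length_append] at hz3
          nlinarith
    · rw [keepNontrivial_cons_of_ne ha]
      -- Now `x'` has the nontrivial value of the peeled letter, so it is not empty. A single letter
      -- `e` simply stands in for `(a, b)`; this is why parallel edges are free. Two or more letters
      -- shrink to one, which pays for `c`.
      rcases x' with _ | ⟨e, _ | ⟨e', x''⟩⟩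
      · exact absurd hval.symm ha
      · exact ⟨e :: y', k, List.Forall₂.cons hval.symm hy', by rwa [mul_mk] at hz2, hz3⟩
      · refine ⟨(a, b) :: y', c + k, List.Forall₂.cons rfl hy', ?_, ?_⟩
        · have h1 := (hc ([(a, b)] ++ invRev (e :: e' :: x''))
            (by rw [List.length_append, invRev_length]; simp only [List.length_cons] at hxlen ⊢
                simp; omega)
            (wordVal_eq_one_iff.1 (by rw [wordVal_append, wordVal_invRev, hval, mul_inv_cancel]))).mul
            hz2
          rw [← mul_mk, ← inv_mk, mul_assoc, inv_mul_cancel_left, mul_mk] at h1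
          exact h1
        · simp only [List.cons_append, List.length_cons, List.length_append] at hz3 ⊢
          nlinarith

/-- The bound `M + 2` also covers the words of length at most two used to recover `w` from `w'`. -/
theorem Decomposes.areaLE {M c : ℕ} (hM : ∀ r ∈ P.symRelators, r.length ≤ M)
    (hc : ∀ w : List (α × Bool), w.length ≤ M + 2 → FreeGroup.mk w ∈ P.kernel → P.AreaLE c (FreeGroup.mk w))
    {w : List (α × Bool)} {v f : ℕ} (h : P.Decomposes w v f) :
    P.AreaLE (2 * c * v + c * w.length) (FreeGroup.mk w) := by
  obtain ⟨w', k, h1, h2, h3⟩ := h.exists_letterwiseEq hM hc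
  have h4 := (AreaLE.of_letterwiseEq (fun w hw => hc w (by omega)) h1).mul h2
  rw [inv_mul_cancel_right] at h4
  exact h4.mono (by omega)

end Collapse

end GroupPresentation

/-! ### Locating cancellations in words -/

namespace FreeGroup

variable {α : Type*}

/-- Undo the reduction step by step: each reinserted pair of inverse letters can be assigned to the
trivial word before `c` or to the one after it. -/
theorem exists_append_of_red_singleton {L : List (α × Bool)} {c : α × Bool} (h : Red L [c]) :
    ∃ U Z, L = U ++ c :: Z ∧ mk U = 1 ∧ mk Z = 1 := by
  induction h using Relation.ReflTransGen.head_induction_on with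
  | refl => exact ⟨[], [], rfl, rfl, rfl⟩
  | head hstep _ ih =>
    obtain ⟨U, Z, hUZ, hU, hZ⟩ := ih
    cases hstep with
    | @not L₁ L₂ x b =>
      have hpair : ∀ A B : List (α × Bool), mk (A ++ (x, b) :: (x, !b) :: B) = mk (A ++ B) :=
        fun A B => Quot.sound Red.Step.not
      rcases List.append_eq_append_iff.1 hUZ with ⟨a, rfl, rfl⟩ | ⟨a, rfl, ha⟩
      · exact ⟨L₁ ++ (x, b) :: (x, !b) :: a, Z, by simp, by rw [hpair, hU], hZ⟩
      · cases a with
        | nil =>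
          obtain rfl : L₂ = c :: Z := ha.symm
          exact ⟨U ++ (x, b) :: (x, !b) :: [], Z, by simp, by rw [hpair, List.append_nil, hU], hZ⟩
        | cons d a =>
          simp only [List.cons_append, List.cons.injEq] at ha
          obtain ⟨rfl, rfl⟩ := ha
          exact ⟨U, a ++ (x, b) :: (x, !b) :: L₂, by simp, hU, by rw [hpair, hZ]⟩

/-- In a word that is trivial in the free group the first letter cancels against a later one. -/
theorem exists_append_of_mk_cons_eq_one {L : List (α × Bool)} {a : α} {b : Bool}
    (h : mk ((a, b) :: L) = 1) : ∃ U Z, L = U ++ (a, !b) :: Z ∧ mk U = 1 ∧ mk Z = 1 := by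
  obtain ⟨M, h1, h2⟩ := Red.exact.1 (show mk ((a, b) :: L) = mk [] from h)
  rw [Red.nil_iff] at h2
  subst h2
  exact exists_append_of_red_singleton (Red.cons_nil_iff_singleton.1 h1)

end FreeGroup

theorem List.append_eq_append_cons_iff {β : Type*} {X Y p q : List β} {c : β} :
    X ++ Y = p ++ c :: q ↔
      (∃ y, X = p ++ c :: y ∧ q = y ++ Y) ∨ ∃ s, p = X ++ s ∧ Y = s ++ c :: q := by
  constructor
  · intro h
    rcases List.append_eq_append_iff.1 h with ⟨a, rfl, rfl⟩ | ⟨a, rfl, ha⟩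
    · exact Or.inr ⟨a, rfl, rfl⟩
    · cases a with
      | nil => exact Or.inr ⟨[], by simp, ha.symm⟩
      | cons d a =>
        simp only [List.cons_append, List.cons.injEq] at ha
        obtain ⟨rfl, rfl⟩ := ha
        exact Or.inl ⟨a, rfl, rfl⟩
  · rintro (⟨y, rfl, rfl⟩ | ⟨s, rfl, rfl⟩) <;> simp

theorem List.exists_of_flatMap_eq_append_cons {β γ : Type*} {f : γ → List β} {L : List γ}
    {U Z : List β} {c : β} (h : L.flatMap f = U ++ c :: Z) :
    ∃ L₁ i L₂ p q, L = L₁ ++ i :: L₂ ∧ f i = p ++ c :: q ∧ U = L₁.flatMap f ++ p ∧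
      Z = q ++ L₂.flatMap f := by
  induction L generalizing U with
  | nil => simp at h
  | cons j L ih =>
    rw [List.flatMap_cons, List.append_eq_append_cons_iff] at h
    rcases h with ⟨y, hy, rfl⟩ | ⟨s, rfl, hs⟩
    · exact ⟨[], j, L, U, y, rfl, hy, rfl, rfl⟩
    · obtain ⟨L₁, i, L₂, p, q, rfl, hi, rfl, rfl⟩ := ih hs
      exact ⟨j :: L₁, i, L₂, p, q, rfl, hi, by simp, rfl⟩

/-! ### Van Kampen's lemma in terms of words -/

namespace GroupPresentation

open FreeGroup (invRev invRev_length inv_mk mul_mk)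

variable {α : Type*} {P : GroupPresentation α}

/-- A letter of the boundary word, or a conjugate `g r g⁻¹` of a relator. -/
inductive DecoratedLetter (α : Type*)
  | letter (a : α × Bool)
  | cell (g r : List (α × Bool))

/-- The word that a decorated letter stands for. -/
def DecoratedLetter.expand : DecoratedLetter α → List (α × Bool)
  | .letter a => [a]
  | .cell g r => g ++ (r ++ invRev g)

/-- The decorated letter stands for a conjugate of a relator if it is not a letter. -/
def DecoratedLetter.IsValid (P : GroupPresentation α) : DecoratedLetter α → Prop
  | .letter _ => True
  | .cell _ r => r ∈ P.symRelators

open DecoratedLetter (letter cell)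

/-- The word that a decorated word stands for. -/
def expandWord (L : List (DecoratedLetter α)) : List (α × Bool) := L.flatMap DecoratedLetter.expand

/-- The letters of a decorated word. -/
def boundaryWord : List (DecoratedLetter α) → List (α × Bool)
  | [] => []
  | .letter a :: L => a :: boundaryWord L
  | .cell _ _ :: L => boundaryWord L

/-- The number of conjugates of relators in a decorated word. -/
def cellCount : List (DecoratedLetter α) → ℕ
  | [] => 0
  | .letter _ :: L => cellCount L
  | .cell _ _ :: L => cellCount L + 1

section Simp

variable (L L' : List (DecoratedLetter α)) (e : α × Bool) (g r w : List (α × Bool))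

theorem expandWord_append : expandWord (L ++ L') = expandWord L ++ expandWord L' :=
  List.flatMap_append

theorem expandWord_letter : expandWord (letter e :: L) = e :: expandWord L := rfl

theorem expandWord_cell :
    expandWord (cell g r :: L) = g ++ (r ++ invRev g) ++ expandWord L := rfl

theorem expandWord_map : expandWord (w.map letter) = w := by
  rw [expandWord, List.flatMap_map]; exact List.flatMap_singleton' w

theorem boundaryWord_letter : boundaryWord (letter e :: L) = e :: boundaryWord L := rfl

theorem boundaryWord_cell : boundaryWord (cell g r :: L) = boundaryWord L := rfl

theorem boundaryWord_append : boundaryWord (L ++ L') = boundaryWord L ++ boundaryWord L' := by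
  induction L with
  | nil => rfl
  | cons i L ih => cases i <;> simp [boundaryWord, ih]

theorem boundaryWord_map : boundaryWord (w.map letter) = w := by
  induction w with
  | nil => rfl
  | cons i w ih => simp [boundaryWord, ih]

theorem cellCount_letter : cellCount (letter e :: L) = cellCount L := rfl

theorem cellCount_cell : cellCount (cell g r :: L) = cellCount L + 1 := rfl

theorem cellCount_append : cellCount (L ++ L') = cellCount L + cellCount L' := by
  induction L with
  | nil => simp [cellCount]
  | cons i L ih => cases i <;> simp [cellCount, ih, Nat.add_right_comm]

theorem cellCount_map : cellCount (w.map letter) = 0 := by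
  induction w with
  | nil => rfl
  | cons i w ih => simp [cellCount, ih]

end Simp

theorem boundaryWord_eq_nil_or (L : List (DecoratedLetter α)) :
    boundaryWord L = [] ∨ ∃ C e L', L = C ++ letter e :: L' ∧ boundaryWord C = [] := by
  induction L with
  | nil => exact Or.inl rfl
  | cons i L ih =>
    rcases i with e | ⟨g, r⟩
    · exact Or.inr ⟨[], e, L, rfl, rfl⟩
    · rcases ih with h | ⟨C, e, L', rfl, hC⟩
      · exact Or.inl h
      · exact Or.inr ⟨cell g r :: C, e, L', rfl, hC⟩

/-- Decorated words that are trivial in the free group describe planar diagrams. -/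
theorem exists_decomposes_of_decorated (L : List (DecoratedLetter α))
    (hL : ∀ i ∈ L, i.IsValid P) (h1 : FreeGroup.mk (expandWord L) = 1) :
    ∃ v f, P.Decomposes (boundaryWord L) v f ∧ f ≤ cellCount L := by
  -- The first boundary letter cancels against some letter of the expansion. If that is a boundary
  -- letter, the edge is a bridge; if it lies in the relator of a cell, the edge borders that face;
  -- if it lies in the conjugating part, that part gets shorter. The expansion shrinks each time.
  induction hn : (expandWord L).length using Nat.strong_induction_on generalizing L with
  | _ n ih =>
    have hcons : ∀ (e : α × Bool) (W : List (α × Bool)), e :: W = [e] ++ W := fun _ _ => rfl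
    have main : ∀ (a : α) (b : Bool) (L : List (DecoratedLetter α)),
        (∀ i ∈ L, i.IsValid P) → FreeGroup.mk ((a, b) :: expandWord L) = 1 →
        (expandWord L).length + 1 = n →
        ∃ v f, P.Decomposes ((a, b) :: boundaryWord L) v f ∧ f ≤ cellCount L := by
      clear h1 hn hL L
      intro a b L hL h1 hn
      obtain ⟨U, Z, hUZ, hU, hZ⟩ := FreeGroup.exists_append_of_mk_cons_eq_one h1
      obtain ⟨L₁, i, L₂, p, q, rfl, hi, rfl, rfl⟩ := List.exists_of_flatMap_eq_append_cons hUZ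
      change FreeGroup.mk (expandWord L₁ ++ p) = 1 at hU
      change FreeGroup.mk (q ++ expandWord L₂) = 1 at hZ
      clear hUZ h1
      have hL₁ : ∀ i ∈ L₁, i.IsValid P := fun i hi => hL i (by simp [hi])
      have hL₂ : ∀ i ∈ L₂, i.IsValid P := fun i hi => hL i (by simp [hi])
      have hLL : ∀ i ∈ L₁ ++ L₂, i.IsValid P := fun i hi => by
        rcases List.mem_append.1 hi with h | h
        exacts [hL₁ i h, hL₂ i h]
      have hiv := hL i (by simp)
      clear hL
      rcases i with e | ⟨g, r⟩
      · obtain ⟨rfl, h⟩ : p = [] ∧ (a, !b) :: q = [e] := by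
          cases p with
          | nil => exact ⟨rfl, hi.symm⟩
          | cons x p => simp [DecoratedLetter.expand] at hi
        simp only [List.cons.injEq] at h
        obtain ⟨rfl, rfl⟩ := h
        simp only [expandWord_append, expandWord_letter, List.length_append, List.length_cons] at hn
        rw [List.append_nil] at hU
        rw [List.nil_append] at hZ
        obtain ⟨v₁, f₁, h1, hf1⟩ := ih _ (by omega) L₁ hL₁ hU rfl
        obtain ⟨v₂, f₂, h2, hf2⟩ := ih _ (by omega) L₂ hL₂ hZ rfl
        refine ⟨v₁ + v₂, f₁ + f₂, ?_, ?_⟩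
        · rw [boundaryWord_append, boundaryWord_letter]
          exact .bridge a b h1 h2
        · rw [cellCount_append, cellCount_letter]; omega
      · have hr : r ∈ P.symRelators := hiv
        have hi' : g ++ (r ++ invRev g) = p ++ (a, !b) :: q := hi
        simp only [expandWord_append, expandWord_cell, List.length_append, invRev_length] at hn
        rw [boundaryWord_append, boundaryWord_cell, cellCount_append, cellCount_cell]
        rw [← mul_mk] at hU hZ
        clear hi hiv
        -- In the conjugator `g = p a⁻¹ g₂`: the part up to this letter is trivial, so the cell,
        -- with conjugator `g₂`, can be put in front of the letter.
        rcases List.append_eq_append_cons_iff.1 hi' with ⟨g₂, rfl, rfl⟩ | ⟨s, rfl, hs⟩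
        · obtain ⟨v, f, h, hf⟩ := ih _ (by
                simp only [expandWord_append, expandWord_letter, expandWord_cell,
                  List.length_append, List.length_cons, invRev_length] at hn ⊢
                omega)
            (cell g₂ r :: letter (a, b) :: (L₁ ++ L₂)) (by
                intro j hj
                simp only [List.mem_cons] at hj
                rcases hj with rfl | rfl | hj
                exacts [hr, trivial, hLL j hj]) (by
                have hinv : invRev (p ++ (a, !b) :: g₂) =
                    invRev g₂ ++ ([(a, b)] ++ invRev p) := by simp [invRev]
                rw [hinv] at hZ
                have hx := eq_inv_of_mul_eq_one_left hU
                rw [expandWord_cell, expandWord_letter, expandWord_append, hcons (a, b)]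
                simp only [← mul_mk, ← inv_mk, hx] at hZ ⊢
                rw [← hZ]
                group) rfl
          rw [boundaryWord_cell, boundaryWord_letter, boundaryWord_append] at h
          rw [cellCount_cell, cellCount_letter, cellCount_append] at hf
          exact ⟨v, f, h, by omega⟩
        -- In the relator `r = s a⁻¹ r₂`, the cell is opened: the rest `r₂ s` of its boundary
        -- replaces the letter. In `g⁻¹ = s a⁻¹ q`, the cell, with conjugator `s⁻¹`, moves just
        -- behind the letter.
        · rcases List.append_eq_append_cons_iff.1 hs with ⟨r₂, rfl, rfl⟩ | ⟨s, rfl, hs'⟩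
          · obtain ⟨v, f, h, hf⟩ := ih _ (by
                  simp only [expandWord_append, expandWord_map, List.length_append,
                    List.length_cons] at hn ⊢
                  omega)
              ((r₂ ++ s).map letter ++ (L₁ ++ L₂)) (by
                  intro j hj
                  rcases List.mem_append.1 hj with hj | hj
                  · obtain ⟨e, -, rfl⟩ := List.mem_map.1 hj
                    trivial
                  · exact hLL j hj) (by
                  rw [expandWord_append, expandWord_map, expandWord_append]
                  simp only [← mul_mk, ← inv_mk] at hU hZ ⊢
                  have hx := eq_inv_of_mul_eq_one_left hU
                  rw [hx, ← hZ]
                  group) rfl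
            rw [boundaryWord_append, boundaryWord_map, boundaryWord_append] at h
            rw [cellCount_append, cellCount_map, cellCount_append] at hf
            refine ⟨v, f + 1, .face a b h (P.symRelators_of_isRotated hr ?_), by omega⟩
            rw [← List.cons_append]
            exact List.isRotated_append
          · obtain rfl : g = invRev q ++ ([(a, b)] ++ invRev s) := by
              rw [← FreeGroup.invRev_invRev (L₁ := g), hs']; simp [invRev]
            obtain ⟨v, f, h, hf⟩ := ih _ (by
                  simp only [expandWord_append, expandWord_letter, expandWord_cell,
                    List.length_append, List.length_cons, invRev_length] at hn ⊢
                  omega)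
              (letter (a, b) :: cell (invRev s) r :: (L₁ ++ L₂)) (by
                  intro j hj
                  simp only [List.mem_cons] at hj
                  rcases hj with rfl | rfl | hj
                  exacts [trivial, hr, hLL j hj]) (by
                  rw [expandWord_letter, expandWord_cell, expandWord_append, hcons (a, b)]
                  simp only [← mul_mk, ← inv_mk] at hU hZ ⊢
                  have hx := eq_inv_of_mul_eq_one_left hU
                  rw [hx, ← hZ]
                  group) rfl
            rw [boundaryWord_letter, boundaryWord_cell, boundaryWord_append] at h
            rw [cellCount_letter, cellCount_cell, cellCount_append] at hf
            exact ⟨v, f, h, by omega⟩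
    -- Without boundary letters a single vertex suffices and the cells are dropped. Otherwise the
    -- cells before the first letter are rotated to the end, which keeps the boundary word and
    -- triviality.
    rcases boundaryWord_eq_nil_or L with h | ⟨C, e, L', rfl, hC⟩
    · rw [h]
      exact ⟨1, 0, .nil, Nat.zero_le _⟩
    · rw [expandWord_append, expandWord_letter] at h1 hn
      obtain ⟨v, f, h, hf⟩ := main e.1 e.2 (L' ++ C) (fun j hj => hL j (by
          simp only [List.mem_append, List.mem_cons] at hj ⊢
          tauto)) (by
          rw [expandWord_append, ← List.cons_append, ← mul_mk]
          rw [← mul_mk] at h1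
          exact mul_eq_one_iff_eq_inv.2 (eq_inv_of_mul_eq_one_right h1)) (by
          rw [expandWord_append]
          simp only [List.length_append, List.length_cons] at hn ⊢
          omega)
      rw [boundaryWord_append, hC, List.append_nil] at h
      rw [boundaryWord_append, hC, boundaryWord_letter, cellCount_append, cellCount_letter]
      rw [cellCount_append] at hf
      exact ⟨v, f, h, by omega⟩

theorem AreaLE.exists_decorated {k : ℕ} {g : FreeGroup α} (h : P.AreaLE k g) :
    ∃ L : List (DecoratedLetter α), (∀ i ∈ L, i.IsValid P) ∧
      FreeGroup.mk (expandWord L) = g ∧ boundaryWord L = [] ∧ cellCount L ≤ k := by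
  classical
  induction h with
  | one k => exact ⟨[], by simp, rfl, rfl, Nat.zero_le _⟩
  | @cons k r h g hr _ ih =>
    obtain ⟨L, hL, hg, hw, hk⟩ := ih
    refine ⟨cell g.toWord r :: L, ?_, ?_, hw, Nat.succ_le_succ hk⟩
    · intro i hi
      rcases List.mem_cons.1 hi with rfl | hi
      exacts [hr, hL i hi]
    · rw [expandWord_cell, ← mul_mk, ← mul_mk, ← mul_mk, ← inv_mk, FreeGroup.mk_toWord, hg]
      group

/-- A word of area at most `k` is the boundary label of a diagram with at most `k` faces. -/
theorem AreaLE.exists_decomposes {k : ℕ} {w : List (α × Bool)} (h : P.AreaLE k (FreeGroup.mk w)) :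
    ∃ v f, P.Decomposes w v f ∧ f ≤ k := by
  -- The inverse of `w` written with cells, followed by the letters of `w`, is trivial in the free
  -- group.
  obtain ⟨L, hL, hg, hw, hk⟩ := h.inv.exists_decorated
  obtain ⟨v, f, h1, hf⟩ := exists_decomposes_of_decorated (P := P) (L ++ w.map letter)
    (fun i hi => by
      rcases List.mem_append.1 hi with hi | hi
      · exact hL i hi
      · obtain ⟨e, -, rfl⟩ := List.mem_map.1 hi
        trivial)
    (by rw [expandWord_append, expandWord_map, ← mul_mk, hg, inv_mul_cancel])
  rw [boundaryWord_append, hw, boundaryWord_map, List.nil_append] at h1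
  rw [cellCount_append, cellCount_map] at hf
  exact ⟨v, f, h1, by omega⟩

end GroupPresentation

/-! ### Transport and rotation of cycles -/

section Semiconj

variable {A D : Type*} {σ : Perm D} {τ : Perm A} {f : A → D}

theorem sameCycle_semiconj_iff (hf : Function.Injective f) (h : ∀ x, σ (f x) = f (τ x)) {x y : A} :
    SameCycle σ (f x) (f y) ↔ SameCycle τ x y := by
  have hpow : ∀ (n : ℕ) x, (σ ^ n) (f x) = f ((τ ^ n) x) := by
    intro n
    induction n with
    | zero => intro x; rfl
    | succ n ih => intro x; rw [pow_succ', Perm.mul_apply, ih, h, pow_succ', Perm.mul_apply]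
  have hz : ∀ (i : ℤ) x, (σ ^ i) (f x) = f ((τ ^ i) x) := by
    intro i x
    obtain ⟨n, rfl | rfl⟩ := i.eq_nat_or_neg
    · exact hpow n x
    · rw [zpow_neg, zpow_neg, Perm.inv_eq_iff_eq, zpow_natCast, zpow_natCast, hpow]
      simp
  constructor
  · rintro ⟨i, hi⟩
    exact ⟨i, hf ((hz i x).symm.trans hi)⟩
  · rintro ⟨i, rfl⟩
    exact ⟨i, hz i x⟩

theorem comap_cycleSetoid (hf : Function.Injective f) (h : ∀ x, σ (f x) = f (τ x)) :
    (cycleSetoid σ).comap f = cycleSetoid τ :=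
  Setoid.ext fun _ _ => sameCycle_semiconj_iff hf h

theorem IsCycleList.map_semiconj (hf : Function.Injective f) (h : ∀ x, σ (f x) = f (τ x)) {x : A}
    {l : List A} (hl : IsCycleList τ x l) : IsCycleList σ (f x) (l.map f) := by
  refine ⟨?_, hl.nodup.map hf, by simpa using hl.ne_nil⟩
  have key : ∀ (l : List A) (x y : A), IsWalk τ x l y → IsWalk σ (f x) (l.map f) (f y) := by
    intro l
    induction l with
    | nil => rintro x _ rfl; rfl
    | cons a l ih =>
      rintro x y ⟨rfl, hw⟩
      refine ⟨rfl, ?_⟩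
      rw [h]
      exact ih _ _ hw
  exact key _ _ _ hl.walk

end Semiconj

section Rotate

variable {D : Type*} {σ : Perm D}

theorem IsCycleList.rotate {x z : D} {s t : List D} (h : IsCycleList σ x (s ++ z :: t)) :
    IsCycleList σ z (z :: t ++ s) := by
  obtain ⟨y, h1, h2⟩ := isWalk_append.1 h.walk
  obtain rfl : y = z := h2.1
  exact ⟨h2.append h1, List.nodup_append_comm.1 h.nodup, by simp⟩

theorem cycleLabel_isRotated {α : Type*} {E : Type} [Finite E] {letter : E → α}
    {φ : Perm (E × Bool)} {x y : E × Bool} (h : SameCycle φ x y) :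
    (cycleLabel letter φ y).IsRotated (cycleLabel letter φ x) := by
  have hx := isCycleList_iterate φ x
  obtain ⟨s, t, hst⟩ := List.append_of_mem (hx.mem_iff.2 h)
  rw [hst] at hx
  rw [hx.cycleLabel_eq, hx.rotate.cycleLabel_eq]
  exact List.isRotated_append.map _

end Rotate

/-! ### Realizing peelings by spherical maps -/

section DiscMap

variable {α : Type*} (P : GroupPresentation α)

/-- A connected spherical combinatorial map with `f + 1` faces, all of them labelled by relators,
except possibly the one on the left of `d`. -/
structure IsDiscMap {E : Type} (letter : E → α) (φ : Perm (E × Bool)) (d : E × Bool) (f : ℕ) :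
    Prop where
  connected : ∀ x y, compSetoid φ x y
  cycleCount_eq : cycleCount φ = f + 1
  euler : cycleCount φ + cycleCount (vertexPerm φ) = Nat.card E + 2
  disc : ∀ x, SameCycle φ d x ∨ cycleLabel letter φ x ∈ P.symRelators

/-- There is a disc map with boundary label `w` and `f` inner faces. -/
def IsRealizable (w : List (α × Bool)) (f : ℕ) : Prop :=
  ∃ (E : Type) (_ : Finite E) (letter : E → α) (φ : Perm (E × Bool)) (d : E × Bool)
    (l : List (E × Bool)), IsDiscMap P letter φ d f ∧ IsCycleList φ d l ∧
      l.map (dartLabel letter) = w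

variable {P}

theorem IsRealizable.isRotated {w w' : List (α × Bool)} {f : ℕ} (h : IsRealizable P w f)
    (hw : w.IsRotated w') : IsRealizable P w' f := by
  obtain ⟨n, rfl⟩ := hw
  induction n with
  | zero => rwa [List.rotate_zero]
  | succ n ih =>
    obtain ⟨E, hE, letter, φ, d, l, hm, hl, hw⟩ := ih
    obtain ⟨t, rfl⟩ := hl.exists_cons
    have hc : IsCycleList φ (φ d) (t ++ [d]) :=
      ⟨hl.walk.2.append ⟨rfl, rfl⟩, List.nodup_append_comm.1 (by simpa using hl.nodup), by simp⟩
    refine ⟨E, hE, letter, φ, φ d, t ++ [d], ⟨hm.connected, hm.cycleCount_eq, hm.euler, fun x => ?_⟩,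
      hc, ?_⟩
    · exact (hm.disc x).imp (fun h => sameCycle_apply_left.2 h) id
    · rw [← List.rotate_rotate, ← hw, List.map_cons, List.rotate_cons_succ, List.rotate_zero]
      simp

theorem isDiscMap_segment (a : α) (b : Bool) :
    IsDiscMap P (fun _ : Unit => a) (reverseEdge Unit) ((), b) 0 ∧
      IsCycleList (reverseEdge Unit) ((), b) [((), b), ((), !b)] := by
  have hs : ∀ x y : Unit × Bool, SameCycle (reverseEdge Unit) x y :=
    fun _ _ => reverseEdge_sameCycle_iff.2 rfl
  have hbot : cycleSetoid (1 : Perm (Unit × Bool)) = ⊥ :=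
    le_bot_iff.1 (cycleSetoid_le_iff.2 fun _ => rfl)
  refine ⟨⟨fun x y => cycleSetoid_le_compSetoid _ (hs x y), ?_, ?_, fun x => Or.inl (hs _ x)⟩, ?_⟩
  · rw [cycleCount_reverseEdge]; simp
  · rw [cycleCount_reverseEdge, vertexPerm, reverseEdge_mul_self, cycleCount, hbot, classCount_bot]
    simp
  · exact ⟨⟨rfl, rfl, by simp [IsWalk]⟩, by simp, by simp⟩

/-- A face with a single boundary edge is treated separately: removing it leaves an empty boundary
word, so there is no map with a base edge to attach to. -/
theorem isRealizable_monogon (a : α) (b : Bool) (h : [(a, !b)] ∈ P.symRelators) :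
    IsRealizable P [(a, b)] 1 := by
  have hbot : cycleSetoid (1 : Perm (Unit × Bool)) = ⊥ :=
    le_bot_iff.1 (cycleSetoid_le_iff.2 fun _ => rfl)
  have hl : ∀ x : Unit × Bool, IsCycleList (1 : Perm (Unit × Bool)) x [x] :=
    fun x => ⟨⟨rfl, rfl⟩, by simp, by simp⟩
  refine ⟨Unit, inferInstance, fun _ => a, 1, ((), b), _, ⟨fun x y => ?_, ?_, ?_, fun x => ?_⟩,
    hl _, rfl⟩
  · exact (le_sup_right : _ ≤ compSetoid _)
      (reverseEdge_sameCycle_iff.2 rfl : SameCycle (reverseEdge Unit) x y)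
  · rw [cycleCount, hbot, classCount_bot]; simp
  · rw [vertexPerm, one_mul, cycleCount_reverseEdge, cycleCount, hbot, classCount_bot]; simp
  · rcases x with ⟨⟨⟩, c⟩
    by_cases hc : c = b
    · subst hc; exact Or.inl (SameCycle.refl _ _)
    · right
      obtain rfl : c = !b := by cases b <;> cases c <;> simp_all
      rw [(hl _).cycleLabel_eq]
      exact h

section Concat

variable {E₁ E₂ : Type}

/-- The disjoint union of two combinatorial maps. -/
def disjointMap (φ₁ : Perm (E₁ × Bool)) (φ₂ : Perm (E₂ × Bool)) : Perm ((E₁ ⊕ E₂) × Bool) :=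
  ((Equiv.sumProdDistrib E₁ E₂ Bool).trans (Equiv.sumCongr φ₁ φ₂)).trans
    (Equiv.sumProdDistrib E₁ E₂ Bool).symm

/-- The inclusion of the oriented edges of the first part into those of a disjoint union. -/
def dartInl (x : E₁ × Bool) : (E₁ ⊕ E₂) × Bool := (Sum.inl x.1, x.2)

/-- The inclusion of the oriented edges of the second part into those of a disjoint union. -/
def dartInr (x : E₂ × Bool) : (E₁ ⊕ E₂) × Bool := (Sum.inr x.1, x.2)

theorem dartInl_injective : Function.Injective (dartInl : E₁ × Bool → (E₁ ⊕ E₂) × Bool) := by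
  rintro ⟨e, b⟩ ⟨e', b'⟩ h
  simpa [dartInl] using h

theorem dartInr_injective : Function.Injective (dartInr : E₂ × Bool → (E₁ ⊕ E₂) × Bool) := by
  rintro ⟨e, b⟩ ⟨e', b'⟩ h
  simpa [dartInr] using h

theorem dartInl_or_dartInr (z : (E₁ ⊕ E₂) × Bool) :
    (∃ x, dartInl x = z) ∨ ∃ y, dartInr y = z := by
  rcases z with ⟨e | e, b⟩
  · exact Or.inl ⟨(e, b), rfl⟩
  · exact Or.inr ⟨(e, b), rfl⟩

/-- The permutations act separately on the two parts of a disjoint union. -/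
structure IsDisjointUnion (σ : Perm ((E₁ ⊕ E₂) × Bool)) (σ₁ : Perm (E₁ × Bool))
    (σ₂ : Perm (E₂ × Bool)) : Prop where
  inl : ∀ x, σ (dartInl x) = dartInl (σ₁ x)
  inr : ∀ x, σ (dartInr x) = dartInr (σ₂ x)

theorem isDisjointUnion_disjointMap (φ₁ : Perm (E₁ × Bool)) (φ₂ : Perm (E₂ × Bool)) :
    IsDisjointUnion (disjointMap φ₁ φ₂) φ₁ φ₂ := ⟨fun _ => rfl, fun _ => rfl⟩

variable {σ : Perm ((E₁ ⊕ E₂) × Bool)} {σ₁ : Perm (E₁ × Bool)} {σ₂ : Perm (E₂ × Bool)}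

theorem IsDisjointUnion.vertexPerm (h : IsDisjointUnion σ σ₁ σ₂) :
    IsDisjointUnion (vertexPerm σ) (vertexPerm σ₁) (vertexPerm σ₂) :=
  ⟨fun x => h.inl (reverseEdge E₁ x), fun x => h.inr (reverseEdge E₂ x)⟩

theorem IsDisjointUnion.not_sameCycle (h : IsDisjointUnion σ σ₁ σ₂) (x : E₁ × Bool)
    (y : E₂ × Bool) : ¬ SameCycle σ (dartInl x) (dartInr y) := by
  intro hs
  have hle : cycleSetoid σ ≤ Setoid.ker fun z => z.1.isLeft := cycleSetoid_le_iff.2 fun z => by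
    rcases dartInl_or_dartInr z with ⟨x, rfl⟩ | ⟨y, rfl⟩
    · rw [h.inl]; rfl
    · rw [h.inr]; rfl
  simpa [dartInl, dartInr] using hle hs

theorem IsDisjointUnion.cycleCount_eq [Finite E₁] [Finite E₂] (h : IsDisjointUnion σ σ₁ σ₂) :
    cycleCount σ = cycleCount σ₁ + cycleCount σ₂ := by
  rw [cycleCount, classCount_eq_add (cycleSetoid σ) dartInl dartInr h.not_sameCycle,
    comap_cycleSetoid dartInl_injective h.inl, comap_cycleSetoid dartInr_injective h.inr]
  intro z
  rcases dartInl_or_dartInr z with ⟨x, rfl⟩ | ⟨y, rfl⟩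
  · exact Or.inl ⟨x, (cycleSetoid σ).refl _⟩
  · exact Or.inr ⟨y, (cycleSetoid σ).refl _⟩

/-- Gluing two disc maps at a boundary vertex. -/
theorem exists_isDiscMap_concat [Finite E₁] [Finite E₂] {letter₁ : E₁ → α} {letter₂ : E₂ → α}
    {φ₁ : Perm (E₁ × Bool)} {φ₂ : Perm (E₂ × Bool)} {d₁ : E₁ × Bool} {d₂ : E₂ × Bool} {f₁ f₂ : ℕ}
    {l₁ : List (E₁ × Bool)} {l₂ : List (E₂ × Bool)} (h₁ : IsDiscMap P letter₁ φ₁ d₁ f₁)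
    (h₂ : IsDiscMap P letter₂ φ₂ d₂ f₂) (hl₁ : IsCycleList φ₁ d₁ l₁)
    (hl₂ : IsCycleList φ₂ d₂ l₂) :
    ∃ φ, IsDiscMap P (Sum.elim letter₁ letter₂) φ (dartInl d₁) (f₁ + f₂) ∧
      IsCycleList φ (dartInl d₁) (l₁.map dartInl ++ l₂.map dartInr) := by
  classical
  set a : (E₁ ⊕ E₂) × Bool := dartInl d₁ with ha
  set b : (E₁ ⊕ E₂) × Bool := dartInr d₂ with hb
  have hu := isDisjointUnion_disjointMap φ₁ φ₂
  set φ₀ := disjointMap φ₁ φ₂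
  have hn : ¬ SameCycle φ₀ a b := hu.not_sameCycle _ _
  -- The transposition joins the two outer faces and also the origins of `a` and `b`, so faces and
  -- vertices drop by one each.
  have hc := cycleCount_swap_mul_of_not hn
  have hcv := cycleCount_swap_mul_of_not (hu.vertexPerm.not_sameCycle d₁ d₂)
  rw [← mul_assoc, hu.vertexPerm.cycleCount_eq] at hcv
  change _ = cycleCount (vertexPerm (swap a b * φ₀)) + 1 at hcv
  rw [hu.cycleCount_eq] at hc
  have hglue := cycleSetoid_swap_mul_of_not hn
  have hl₁' := hl₁.map_semiconj dartInl_injective hu.inl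
  have hl₂' := hl₂.map_semiconj dartInr_injective hu.inr
  have hlist : IsCycleList (swap a b * φ₀) a (l₁.map dartInl ++ l₂.map dartInr) := by
    have hdis : ∀ z ∈ l₁.map (dartInl (E₂ := E₂)), ∀ w ∈ l₂.map (dartInr (E₁ := E₁)), z ≠ w := by
      intro z hz w hw
      obtain ⟨x, -, rfl⟩ := List.mem_map.1 hz
      obtain ⟨y, -, rfl⟩ := List.mem_map.1 hw
      simp [dartInl, dartInr]
    refine ⟨IsWalk.append (y := b) ?_ ?_, List.nodup_append.2 ⟨hl₁'.nodup, hl₂'.nodup, hdis⟩, ?_⟩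
    · obtain ⟨t, ht⟩ := hl₁'.exists_cons
      have hw := hl₁'.walk
      have hnd := hl₁'.nodup
      rw [ht] at hw hnd ⊢
      rw [swap_comm]
      refine hw.swap_mul_of_end (List.nodup_cons.1 hnd).1 fun z hz e => ?_
      rw [← ht] at hz
      exact hn (((hl₁'.mem_iff.1 hz).apply_right).trans (by rw [e]))
    · obtain ⟨t, ht⟩ := hl₂'.exists_cons
      have hw := hl₂'.walk
      have hnd := hl₂'.nodup
      rw [ht] at hw hnd ⊢
      refine hw.swap_mul_of_end (List.nodup_cons.1 hnd).1 fun z hz e => ?_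
      rw [← ht] at hz
      exact hn (((hl₂'.mem_iff.1 hz).apply_right).trans (by rw [e])).symm
    · simp [hl₁.ne_nil]
  refine ⟨swap a b * φ₀, ⟨?_, ?_, ?_, ?_⟩, hlist⟩
  · have h1 : compSetoid φ₁ ≤ (compSetoid φ₀).comap dartInl := compSetoid_le_iff.2
      ⟨fun x => by
        change compSetoid φ₀ (dartInl x) (dartInl (φ₁ x))
        rw [← hu.inl]; exact compSetoid_apply_right _ _,
       fun x => compSetoid_reverseEdge φ₀ (dartInl x)⟩
    have h2 : compSetoid φ₂ ≤ (compSetoid φ₀).comap dartInr := compSetoid_le_iff.2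
      ⟨fun x => by
        change compSetoid φ₀ (dartInr x) (dartInr (φ₂ x))
        rw [← hu.inr]; exact compSetoid_apply_right _ _,
       fun x => compSetoid_reverseEdge φ₀ (dartInr x)⟩
    have h3 := glue_compSetoid_swap_mul φ₀ a b
    rw [Setoid.glue_eq_self (cycleSetoid_le_compSetoid _ (sameCycle_swap_mul hn))] at h3
    have h4 : ∀ z, compSetoid (swap a b * φ₀) a z := by
      intro z
      rw [h3]
      rcases dartInl_or_dartInr z with ⟨x, rfl⟩ | ⟨y, rfl⟩
      · exact Or.inl (h1 (h₁.connected d₁ x))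
      · exact Or.inr (Or.inl ⟨(compSetoid φ₀).refl a, h2 (h₂.connected d₂ y)⟩)
    exact fun x y => (compSetoid _).trans ((compSetoid _).symm (h4 x)) (h4 y)
  · have := h₁.cycleCount_eq
    have := h₂.cycleCount_eq
    omega
  · have := h₁.euler
    have := h₂.euler
    rw [Nat.card_sum]
    omega
  · have hab : SameCycle (swap a b * φ₀) a b := sameCycle_swap_mul hn
    have hle : ∀ {x y}, SameCycle φ₀ x y → SameCycle (swap a b * φ₀) x y := fun {x y} h => by
      have : cycleSetoid (swap a b * φ₀) x y := by
        rw [hglue]; exact Setoid.le_glue _ _ _ h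
      exact this
    intro z
    rcases dartInl_or_dartInr z with ⟨x, rfl⟩ | ⟨y, rfl⟩
    · rcases h₁.disc x with h | h
      · exact Or.inl (hle ((sameCycle_semiconj_iff dartInl_injective hu.inl).2 h))
      · by_cases hx : SameCycle φ₁ d₁ x
        · exact Or.inl (hle ((sameCycle_semiconj_iff dartInl_injective hu.inl).2 hx))
        right
        have hcl := (isCycleList_iterate φ₁ x)
        have h5 := (hcl.map_semiconj dartInl_injective hu.inl).swap_mul (a := a) (b := b)
          (fun e => hx ((sameCycle_semiconj_iff dartInl_injective hu.inl).1 e).symm)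
          (hu.not_sameCycle _ _)
        rw [h5.cycleLabel_eq, List.map_map]
        rw [hcl.cycleLabel_eq] at h
        exact h
    · rcases h₂.disc y with h | h
      · exact Or.inl (hab.trans (hle ((sameCycle_semiconj_iff dartInr_injective hu.inr).2 h)))
      · by_cases hy : SameCycle φ₂ d₂ y
        · exact Or.inl (hab.trans (hle ((sameCycle_semiconj_iff dartInr_injective hu.inr).2 hy)))
        right
        have hcl := (isCycleList_iterate φ₂ y)
        have h5 := (hcl.map_semiconj dartInr_injective hu.inr).swap_mul (a := a) (b := b)
          (fun e => hu.not_sameCycle _ _ e.symm)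
          (fun e => hy ((sameCycle_semiconj_iff dartInr_injective hu.inr).1 e).symm)
        rw [h5.cycleLabel_eq, List.map_map]
        rw [hcl.cycleLabel_eq] at h
        exact h

end Concat

theorem IsRealizable.concat {u w : List (α × Bool)} {f g : ℕ} (hu : IsRealizable P u f)
    (hw : IsRealizable P w g) : IsRealizable P (u ++ w) (f + g) := by
  obtain ⟨E₁, _, letter₁, φ₁, d₁, l₁, h₁, hl₁, rfl⟩ := hu
  obtain ⟨E₂, _, letter₂, φ₂, d₂, l₂, h₂, hl₂, rfl⟩ := hw
  obtain ⟨φ, h, hl⟩ := exists_isDiscMap_concat h₁ h₂ hl₁ hl₂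
  refine ⟨E₁ ⊕ E₂, inferInstance, _, φ, _, _, h, hl, ?_⟩
  rw [List.map_append, List.map_map, List.map_map]
  rfl

/-- Connecting the two ends of a part of the boundary path of a disc map by a new edge; the edge is
there already, as a leaf. -/
theorem IsDiscMap.close {E : Type} [Finite E] {letter : E → α} {φ : Perm (E × Bool)}
    {d : E × Bool} {f : ℕ} {x y : List (E × Bool)} (h : IsDiscMap P letter φ d f)
    (hl : IsCycleList φ d (d :: reverseEdge E d :: (x ++ y)))
    (hx : (reverseEdge E d :: x).map (dartLabel letter) ∈ P.symRelators) :
    IsRealizable P ((d :: y).map (dartLabel letter)) (f + 1) := by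
  classical
  have hd : φ d = reverseEdge E d := hl.walk.2.1
  have hinj : ∀ z, φ z = reverseEdge E d → z = d := fun z hz => φ.injective (hz.trans hd.symm)
  have hnd := hl.nodup
  rw [← List.cons_append, List.nodup_cons, List.mem_append, not_or, List.nodup_append] at hnd
  obtain ⟨⟨hd1, hd2⟩, hxnd, hynd, hxy⟩ := hnd
  have hw := hl.walk.2
  rw [hd, ← List.cons_append] at hw
  obtain ⟨p, hw1, hw2⟩ := isWalk_append.1 hw
  generalize hd' : reverseEdge E d = d' at *
  -- The edge `p` that follows `x` is the head of `y`, or `d` itself if `y` is empty.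
  have hpy : p ∈ d :: y := by
    cases y with
    | nil => exact List.mem_cons.2 (Or.inl hw2)
    | cons a y => exact List.mem_cons_of_mem _ (List.mem_cons.2 (Or.inl hw2.1))
  have hpx : p ∉ d' :: x := fun hp => by
    rcases List.mem_cons.1 hpy with rfl | h
    · exact hd1 hp
    · exact hxy p hp p h rfl
  have hdp : d' ≠ p := fun e => hpx (by simp [e])
  have hmem : ∀ z, SameCycle φ d z ↔ z ∈ d' :: x ∨ z ∈ d :: y := fun z => by
    rw [← hl.mem_iff]
    simp only [List.mem_cons, List.mem_append]
    tauto
  have hs : SameCycle φ d' p := ((hmem d').2 (by simp)).symm.trans ((hmem p).2 (Or.inr hpy))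
  have hvd : vertexPerm φ d' = d' := by
    rw [Perm.mul_apply, ← hd', reverseEdge_reverseEdge, hd, hd']
  -- The tip of the leaf is moved to the origin of `p`: the outer face splits in two and the vertex
  -- of degree one merges with that origin, so the Euler count is unchanged.
  have hc := cycleCount_swap_mul_of_sameCycle hdp hs
  have hcv := cycleCount_swap_mul_of_not (σ := vertexPerm φ) (a := d') (b := p)
    fun e => hdp (SameCycle.eq_of_left e hvd)
  rw [← mul_assoc] at hcv
  change _ = cycleCount (vertexPerm (swap d' p * φ)) + 1 at hcv
  have hl1 : IsCycleList (swap d' p * φ) d' (d' :: x) := by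
    refine ⟨hw1.swap_mul_of_end (fun e => hpx (List.mem_cons_of_mem _ e)) fun z hz e => ?_, hxnd,
      by simp⟩
    exact hd1 (hinj z e ▸ hz)
  have hap : (swap d' p * φ) d = p := by rw [Perm.mul_apply, hd, swap_apply_left]
  have hl2 : IsCycleList (swap d' p * φ) d (d :: y) := by
    refine ⟨⟨rfl, ?_⟩, List.nodup_cons.2 ⟨hd2, hynd⟩, by simp⟩
    rw [hap]
    refine hw2.swap_mul fun z hz => ⟨fun e => hd2 (hinj z e ▸ hz), fun e => ?_⟩
    cases y with
    | nil => simp at hz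
    | cons a y =>
      obtain rfl : p = a := hw2.1
      rcases hw2.apply_mem hz with h | h
      · exact (List.nodup_cons.1 hynd).1 (e ▸ h)
      · exact hd2 (by rw [← h, e]; simp)
  refine ⟨E, inferInstance, letter, swap d' p * φ, d, d :: y, ⟨?_, ?_, ?_, ?_⟩, hl2, rfl⟩
  · have h1 := glue_compSetoid_swap_mul φ d' p
    have h2 : compSetoid (swap d' p * φ) d' p := by
      refine (compSetoid _).trans ((compSetoid _).symm (hd' ▸ compSetoid_reverseEdge _ d)) ?_
      have h3 := compSetoid_apply_right (swap d' p * φ) d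
      rwa [hap] at h3
    rw [Setoid.glue_eq_self h2] at h1
    intro z w
    rw [h1]
    exact Or.inl (h.connected z w)
  · rw [hc, h.cycleCount_eq]
  · have := h.euler
    omega
  · intro z
    by_cases hz : SameCycle φ d z
    · rcases (hmem z).1 hz with hz | hz
      · right
        refine P.symRelators_of_isRotated ?_ (cycleLabel_isRotated (hl1.mem_iff.1 hz))
        rwa [hl1.cycleLabel_eq]
      · exact Or.inl (hl2.mem_iff.1 hz)
    · right
      have hcl := isCycleList_iterate φ z
      have h1 := hcl.swap_mul (a := d') (b := p)
        (fun e => hz (((hmem d').2 (by simp)).trans e.symm))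
        (fun e => hz (((hmem p).2 (Or.inr hpy)).trans e.symm))
      have h2 := (h.disc z).resolve_left hz
      rw [hcl.cycleLabel_eq] at h2
      rwa [h1.cycleLabel_eq]

theorem IsRealizable.face {x y : List (α × Bool)} {f : ℕ} {a : α} {b : Bool}
    (h : IsRealizable P (x ++ y) f) (hx : (a, !b) :: x ∈ P.symRelators) :
    IsRealizable P ((a, b) :: y) (f + 1) := by
  obtain ⟨E₂, _, letter₂, φ₂, d₂, l₂, h₂, hl₂, hw⟩ := h
  -- A segment attached at the start of the path `x y` is a leaf; bending its tip to the end of `x`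
  -- closes off the new face.
  obtain ⟨h₁, hl₁⟩ := isDiscMap_segment (P := P) a b
  obtain ⟨φ, hm, hl⟩ := exists_isDiscMap_concat h₁ h₂ hl₁ hl₂
  obtain ⟨l₃, l₄, rfl, rfl, rfl⟩ := List.map_eq_append_iff.1 hw
  rw [List.map_append] at hl
  rw [zero_add] at hm
  have hlab : ∀ l : List (E₂ × Bool), (l.map dartInr).map
      (dartLabel (Sum.elim (fun _ : Unit => a) letter₂)) = l.map (dartLabel letter₂) := fun l => by
    rw [List.map_map]; rfl
  have := hm.close (x := l₃.map dartInr) (y := l₄.map dartInr) hl (by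
    rw [List.map_cons, hlab]; exact hx)
  rwa [List.map_cons, hlab] at this

/-- The one-vertex diagram is listed apart because `IsRealizable` needs a base edge. -/
theorem GroupPresentation.Decomposes.isRealizable {w : List (α × Bool)} {v f : ℕ}
    (h : P.Decomposes w v f) : (w = [] ∧ f = 0) ∨ IsRealizable P w f := by
  have hseg : ∀ (a : α) (b : Bool), IsRealizable P [(a, b), (a, !b)] 0 := fun a b =>
    ⟨Unit, inferInstance, _, _, _, _, (isDiscMap_segment (P := P) a b).1,
      (isDiscMap_segment (P := P) a b).2, rfl⟩
  induction h with
  | nil => exact Or.inl ⟨rfl, rfl⟩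
  | @bridge u w v₁ v₂ f₁ f₂ a b _ _ ihu ihw =>
    right
    have h1 : IsRealizable P ((a, b) :: (u ++ [(a, !b)])) f₁ := by
      rcases ihu with ⟨rfl, rfl⟩ | hu
      · exact hseg a b
      -- A segment attached to `u` gives the boundary `u a⁻¹ a`, a rotation of `a u a⁻¹`.
      · have h2 := hu.concat (hseg a (!b))
        rw [Bool.not_not] at h2
        refine h2.isRotated ?_
        have h3 := List.isRotated_append (l := u ++ [(a, !b)]) (l' := [(a, b)])
        simpa using h3
    rcases ihw with ⟨rfl, rfl⟩ | hw
    · exact h1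
    · have h2 := h1.concat hw
      simpa using h2
  | @face x y v f a b _ hx ih =>
    right
    rcases ih with ⟨h, rfl⟩ | h
    · obtain ⟨rfl, rfl⟩ := List.append_eq_nil_iff.1 h
      exact isRealizable_monogon a b hx
    · exact h.face hx

/-! ### From spherical maps back to diagrams -/

theorem IsDiscMap.exists_diagram {E : Type} [Finite E] {letter : E → α} {φ : Perm (E × Bool)}
    {d : E × Bool} {f : ℕ} (h : IsDiscMap P letter φ d f) :
    ∃ Δ : VanKampenDiagram P, Δ.IsBoundaryLabel (cycleLabel letter φ d) ∧ Δ.numCells 2 = f := by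
  classical
  let q : E × Bool → Quotient (cycleSetoid φ) := Quotient.mk _
  let o : E × Bool → Quotient (cycleSetoid (vertexPerm φ)) := Quotient.mk _
  let left : E × Bool → Option {c : Quotient (cycleSetoid φ) // c ≠ q d} := fun x =>
    if hx : q x = q d then none else some ⟨q x, hx⟩
  have hq : ∀ x y, q x = q y ↔ SameCycle φ x y := fun x y =>
    ⟨fun e => Quotient.exact e, fun e => Quotient.sound e⟩
  have hnone : ∀ x, left x = none ↔ q x = q d := fun x => by
    by_cases hx : q x = q d <;> simp [left, hx]
  have hsome : ∀ x c, left x = some c ↔ q x = c.1 := fun x c => by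
    by_cases hx : q x = q d
    · simp only [left, hx, dif_pos, reduceCtorEq, false_iff]
      exact fun e => c.2 e.symm
    · simp only [left, hx, dif_neg, not_false_eq_true, Option.some.injEq, Subtype.ext_iff]
  have hcard : Nat.card {c : Quotient (cycleSetoid φ) // c ≠ q d} = f := by
    have h1 : Nat.card (Option {c : Quotient (cycleSetoid φ) // c ≠ q d}) = cycleCount φ :=
      Nat.card_congr (Equiv.optionSubtypeNe (q d))
    rw [Finite.card_option, h.cycleCount_eq] at h1
    omega
  refine ⟨
    { Vertex := Quotient (cycleSetoid (vertexPerm φ))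
      Edge := E
      Face := {c : Quotient (cycleSetoid φ) // c ≠ q d}
      finite_vertex := inferInstance
      finite_edge := inferInstance
      finite_face := inferInstance
      letter := letter
      next := φ
      origin := o
      leftFace := left
      origin_eq_iff := fun x y => ⟨fun e => Quotient.exact e, fun e => Quotient.sound e⟩
      leftFace_eq_iff := fun x y => ?_
      exists_leftFace_eq_some := fun c => ?_
      exists_leftFace_eq_none := fun _ => ⟨d, (hnone d).2 rfl⟩
      nonempty_vertex := ⟨o d⟩
      connected := fun v v' => ?_
      euler := ?_
      relator := fun x hx => ?_ }, Or.inl ⟨d, (hnone d).2 rfl, rfl⟩, hcard⟩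
  · rw [← hq]
    cases hy : left y with
    | none => rw [hnone] at hy ⊢; rw [hy]
    | some c => rw [hsome] at hy ⊢; rw [hy]
  · obtain ⟨x, hx⟩ := Quotient.exists_rep c.1
    exact ⟨x, (hsome x c).2 hx⟩
  · induction v using Quotient.inductionOn with | _ x => ?_
    induction v' using Quotient.inductionOn with | _ y => ?_
    let S : Quotient (cycleSetoid (vertexPerm φ)) → Quotient (cycleSetoid (vertexPerm φ)) → Prop :=
      fun u u' => ∃ c, o c = u ∧ o (reverseEdge E c) = u'
    have hS : Std.Symm S := ⟨fun u u' ⟨c, hc, hc'⟩ => ⟨reverseEdge E c, hc', by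
      rwa [reverseEdge_reverseEdge]⟩⟩
    let r : Setoid (E × Bool) :=
      { r := fun x y => Relation.ReflTransGen S (o x) (o y)
        iseqv := ⟨fun _ => .refl, fun h => Relation.ReflTransGen.stdSymm.symm _ _ h,
          fun h h' => h.trans h'⟩ }
    have hle : compSetoid φ ≤ r := by
      refine compSetoid_le_iff.2 ⟨fun c => ?_, fun c => ?_⟩
      · have h1 : o (φ c) = o (reverseEdge E c) := by
          refine Quotient.sound ?_
          exact sameCycle_vertexPerm φ c
        change Relation.ReflTransGen S (o c) (o (φ c))
        rw [h1]
        exact .single ⟨c, rfl, rfl⟩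
      · exact .single ⟨c, rfl, rfl⟩
    exact hle (h.connected x y)
  · have h1 := h.euler
    have h2 := h.cycleCount_eq
    rw [hcard]
    change cycleCount (vertexPerm φ) + f = _
    omega
  · refine (h.disc x).resolve_left fun e => hx ?_
    rw [hnone, hq]
    exact e.symm

/-- The diagram that consists of a single vertex. -/
def trivialDiagram (P : GroupPresentation α) : VanKampenDiagram P where
  Vertex := Unit
  Edge := Empty
  Face := Empty
  finite_vertex := inferInstance
  finite_edge := inferInstance
  finite_face := inferInstance
  letter := Empty.elim
  next := 1
  origin := fun _ => ()
  leftFace := fun d => d.1.elim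
  origin_eq_iff := fun d => d.1.elim
  leftFace_eq_iff := fun d => d.1.elim
  exists_leftFace_eq_some := fun f => f.elim
  exists_leftFace_eq_none := fun ⟨e⟩ => e.elim
  nonempty_vertex := ⟨()⟩
  connected := fun _ _ => .refl
  euler := by simp
  relator := fun d => d.1.elim

theorem GroupPresentation.Decomposes.exists_diagram {w : List (α × Bool)} {v f : ℕ}
    (h : P.Decomposes w v f) :
    ∃ Δ : VanKampenDiagram P, Δ.IsBoundaryLabel w ∧ Δ.numCells 2 = f := by
  rcases h.isRealizable with ⟨rfl, rfl⟩ | ⟨E, _, letter, φ, d, l, hm, hl, rfl⟩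
  · exact ⟨trivialDiagram P, Or.inr ⟨inferInstanceAs (IsEmpty Empty), rfl⟩, by
      simp [VanKampenDiagram.numCells, trivialDiagram]⟩
  · rw [← hl.cycleLabel_eq]
    exact hm.exists_diagram

end DiscMap

/-! ### Comparing minimal cell numbers and Dehn functions -/

namespace GroupPresentation

variable {α : Type*} (P : GroupPresentation α)

theorem minCells_le {j : Fin 3} {w : List (α × Bool)} {Δ : VanKampenDiagram P}
    (h : Δ.IsBoundaryLabel w) : P.minCells j w ≤ Δ.numCells j := Nat.sInf_le ⟨Δ, h, rfl⟩

theorem exists_numCells_eq_minCells (j : Fin 3) {w : List (α × Bool)} {Δ : VanKampenDiagram P}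
    (h : Δ.IsBoundaryLabel w) :
    ∃ Δ' : VanKampenDiagram P, Δ'.IsBoundaryLabel w ∧ Δ'.numCells j = P.minCells j w :=
  Nat.sInf_mem (s := {n | ∃ Δ : VanKampenDiagram P, Δ.IsBoundaryLabel w ∧ Δ.numCells j = n})
    ⟨_, Δ, h, rfl⟩

/-- The infimum of the empty set is `0`, so the comparisons below hold for every word, whether or
not it bounds a diagram. -/
theorem minCells_eq_zero {j : Fin 3} {w : List (α × Bool)}
    (h : ¬ ∃ Δ : VanKampenDiagram P, Δ.IsBoundaryLabel w) : P.minCells j w = 0 := by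
  have : {n | ∃ Δ : VanKampenDiagram P, Δ.IsBoundaryLabel w ∧ Δ.numCells j = n} = ∅ :=
    Set.eq_empty_of_forall_notMem fun n ⟨Δ, hΔ, _⟩ => h ⟨Δ, hΔ⟩
  rw [minCells, this, Nat.sInf_empty]

theorem minCells_zero_le (w : List (α × Bool)) : P.minCells 0 w ≤ P.minCells 1 w + 1 := by
  by_cases h : ∃ Δ : VanKampenDiagram P, Δ.IsBoundaryLabel w
  · obtain ⟨Δ, hΔ⟩ := h
    obtain ⟨Δ', hΔ', h1⟩ := P.exists_numCells_eq_minCells 1 hΔ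
    exact (P.minCells_le hΔ').trans (h1 ▸ Δ'.numCells_zero_le)
  · rw [P.minCells_eq_zero h]; exact Nat.zero_le _

variable {P}

theorem exists_length_le (hP : P.relators.Finite) : ∃ M, ∀ R ∈ P.relators, R.length ≤ M := by
  obtain ⟨M, hM⟩ := (hP.image List.length).bddAbove
  exact ⟨M, fun R hR => hM (Set.mem_image_of_mem _ hR)⟩

theorem exists_minCells_one_le (hP : P.relators.Finite) :
    ∃ M, ∀ w : List (α × Bool), P.minCells 1 w ≤ M * P.minCells 2 w + w.length := by
  obtain ⟨M, hM⟩ := exists_length_le hP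
  refine ⟨M, fun w => ?_⟩
  by_cases h : ∃ Δ : VanKampenDiagram P, Δ.IsBoundaryLabel w
  · obtain ⟨Δ, hΔ⟩ := h
    obtain ⟨Δ', hΔ', h1⟩ := P.exists_numCells_eq_minCells 2 hΔ
    exact (P.minCells_le hΔ').trans (h1 ▸ Δ'.numCells_one_le hM hΔ')
  · rw [P.minCells_eq_zero h]; exact Nat.zero_le _

/-- The number of faces of a minimal diagram is linearly bounded by the number of vertices of any
diagram with the same boundary label. -/
theorem exists_minCells_two_le [Finite α] (hP : P.relators.Finite) :
    ∃ c, ∀ w : List (α × Bool), P.minCells 2 w ≤ 2 * c * P.minCells 0 w + c * w.length := by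
  obtain ⟨M, hM⟩ := exists_length_le hP
  have hM' : ∀ r ∈ P.symRelators, r.length ≤ M := by
    rintro r ⟨R, hR, h | h⟩
    · exact h.perm.length_eq.trans_le (hM R hR)
    · rw [h.perm.length_eq, FreeGroup.invRev_length]
      exact hM R hR
  obtain ⟨c, hc⟩ := P.exists_areaLE_of_length_le (M + 2)
  refine ⟨c, fun w => ?_⟩
  by_cases h : ∃ Δ : VanKampenDiagram P, Δ.IsBoundaryLabel w
  · obtain ⟨Δ, hΔ⟩ := h
    obtain ⟨Δ', hΔ', h1⟩ := P.exists_numCells_eq_minCells 0 hΔ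
    -- From a diagram with fewest vertices only the area bound is kept; the diagram with few faces
    -- is built afresh from it.
    obtain ⟨f, hf⟩ := Δ'.exists_decomposes hΔ'
    rw [h1] at hf
    obtain ⟨v, g, hg, hgle⟩ := (hf.areaLE hM' hc).exists_decomposes
    obtain ⟨Δ'', hΔ'', h2⟩ := hg.exists_diagram
    exact (P.minCells_le hΔ'').trans (h2.trans_le hgle)
  · rw [P.minCells_eq_zero h]; exact Nat.zero_le _

/-- Ensures that the supremum in `dehn` is a true upper bound and not the default value of an
unbounded set. -/
theorem bddAbove_minCells [Finite α] (P : GroupPresentation α) (j : Fin 3) (x : ℕ) :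
    BddAbove {n | ∃ w : List (α × Bool), P.IsTrivialWord w ∧ w.length ≤ x ∧
      P.minCells j w = n} := by
  refine (((List.finite_length_le (α × Bool) x).image (P.minCells j)).subset ?_).bddAbove
  rintro _ ⟨w, -, hw, rfl⟩
  exact ⟨w, hw, rfl⟩

theorem minCells_le_dehn [Finite α] {j : Fin 3} {x : ℕ} {w : List (α × Bool)}
    (h : P.IsTrivialWord w) (hw : w.length ≤ x) : P.minCells j w ≤ P.dehn j x :=
  le_csSup (P.bddAbove_minCells j x) ⟨w, h, hw, rfl⟩

theorem linearlyDominated_dehn [Finite α] {i j : Fin 3} {C : ℕ}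
    (h : ∀ w : List (α × Bool), P.minCells i w ≤ C * P.minCells j w + C * (w.length + 1)) :
    LinearlyDominated (P.dehn i) (P.dehn j) := by
  -- Since `x ≥ 1`, the error `C (|w| + 1)` is at most `2 C x`; the extra `1` makes the constant
  -- positive and gives `|w| ≤ (2C + 1) x`.
  refine ⟨2 * C + 1, Nat.succ_pos _, fun x hx => ?_⟩
  have hne : {n | ∃ w : List (α × Bool), P.IsTrivialWord w ∧ w.length ≤ x ∧
      P.minCells i w = n}.Nonempty :=
    ⟨_, [], one_mem _, Nat.zero_le _, rfl⟩
  refine csSup_le hne ?_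
  rintro _ ⟨w, hw, hwx, rfl⟩
  have hle : w.length ≤ (2 * C + 1) * x := hwx.trans (Nat.le_mul_of_pos_left x (Nat.succ_pos _))
  have h1 : P.minCells j w ≤ P.dehn j ((2 * C + 1) * x) := minCells_le_dehn hw hle
  have h2 : C * (w.length + 1) ≤ (2 * C + 1) * x := by nlinarith
  have h3 : C * P.minCells j w ≤ (2 * C + 1) * P.dehn j ((2 * C + 1) * x) :=
    Nat.mul_le_mul (by omega) h1
  exact (h w).trans (Nat.add_le_add h3 h2)

end GroupPresentation

theorem theorem1p7 {α : Type*} [Finite α] (P : GroupPresentation α)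
    (hP : P.relators.Finite) :
    LinearlyEquivalent (P.dehn 0) (P.dehn 1) ∧
    LinearlyEquivalent (P.dehn 1) (P.dehn 2) ∧
    LinearlyEquivalent (P.dehn 0) (P.dehn 2) := by
  obtain ⟨M, hM⟩ := GroupPresentation.exists_minCells_one_le hP
  obtain ⟨c, hc⟩ := GroupPresentation.exists_minCells_two_le hP
  have h0 := P.minCells_zero_le
  refine ⟨⟨?_, ?_⟩, ⟨?_, ?_⟩, ?_, ?_⟩
  · refine GroupPresentation.linearlyDominated_dehn (C := 1) fun w => ?_
    have := h0 w
    omega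
  -- The constant comes from composing the edge bound with the face bound: `M (2c L₀ + c|w|) + |w|`.
  · refine GroupPresentation.linearlyDominated_dehn (C := M * (2 * c) + M * c + 1) fun w => ?_
    have h1 := hM w
    have h2 := Nat.mul_le_mul_left M (hc w)
    nlinarith [Nat.zero_le (M * c * P.minCells 0 w), Nat.zero_le (M * c * w.length),
      Nat.zero_le (P.minCells 0 w), Nat.zero_le (M * c)]
  · refine GroupPresentation.linearlyDominated_dehn (C := M + 1) fun w => ?_
    have h1 := hM w
    nlinarith [Nat.zero_le (M * w.length)]
  · refine GroupPresentation.linearlyDominated_dehn (C := 2 * c) fun w => ?_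
    have h1 := hc w
    have h2 := Nat.mul_le_mul_left (2 * c) (h0 w)
    nlinarith [Nat.zero_le (c * w.length)]
  · refine GroupPresentation.linearlyDominated_dehn (C := M + 1) fun w => ?_
    have h1 := hM w
    have h2 := h0 w
    nlinarith [Nat.zero_le (M * w.length)]
  · refine GroupPresentation.linearlyDominated_dehn (C := 2 * c) fun w => ?_
    have h1 := hc w
    nlinarith [Nat.zero_le (c * w.length)]
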